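/- A monotone polynomial system (MPS) $x=Q(x)$ in variables $x=(x_1,\dots,x_n)$, $n\ge 1$, consists of equations $x_i=Q_i(x)$ in which each $Q_i$ is a polynomial with non-negative real coefficients; it is quadratic if every $Q_i$ has total degree at most $2$. Its least fixed point (LFP), if it exists, is the least $q^*\in\mathbb R^n_{\ge 0}$ with $q^*=Q(q^*)$. The dependency graph of the system has the variables as nodes and an edge $(x_i,x_j)$ iff $x_j$ appears in $Q_i$; $H_Q$ denotes the DAG of its strongly connected components (SCCs). For an SCC $S$ let $D(S)$ be the set of variables in lower SCCs reachable from $S$, and write the equations of $S$ as $x_S=Q_S(x_S,x_{D(S)})$. The SCC $S$ is linear if the system $x_S=Q_S(x_S,q^*_{D(S)})$ is linear (affine) in $x_S$, and nonlinear otherwise. Let $d$ (resp. the nonlinear depth $f$) be the maximum, over all directed paths of $H_Q$, of the number of SCCs (resp. nonlinear SCCs) on the path. The rounded-down Newton method (R-NM) with rounding parameter $h\in\mathbb Z$ for a system $x=P(x)$ with Jacobian $B(x)$ starts at $x^{[0]}=0$; $x^{[k+1]}_i$ is the greatest integer multiple of $2^{-h}$ that is at most $\max(y_i,0)$, where $y=x^{[k]}+(I-B(x^{[k]}))^{-1}(P(x^{[k]})-x^{[k]})$;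 this is defined if $I-B(x^{[k]})$ is non-singular. The rounded-down decomposed Newton method (R-DNM) with rounding parameter $h$ and $g$ iterations per nonlinear SCC works through the SCCs bottom-up: for an SCC $S$, with the values $\tilde q_{D(S)}$ already computed, $\tilde q_S$ is the result of $g$ iterations (one iteration if $S$ is linear) of R-NM with parameter $h$ for $x_S=Q_S(x_S,\tilde q_{D(S)})$. Theorem. Let $x=Q(x)$ be a quadratic MPS in $n\ge 1$ variables with LFP $q^*\in\mathbb R^n$, $q^*>0$ in every coordinate. Let $c'_{\min}$ be the least positive coefficient (or constant term) of any monomial in $Q(x)$, let $q^*_{\min}$ and $q^*_{\max}$ be the least and greatest coordinates of $q^*$, let $\epsilon'>0$, and put (with logarithms to base $2$) $$u=\max\{0,\lceil\log q^*_{\max}\rceil\},\qquad \alpha'=2^{-2u}\min\{1,c'_{\min}\}\min\{1,\tfrac12 q^*_{\min}\},$$ $$g'=2+\Big\lceil 2^f\Big(\log\tfrac1{\epsilon'}+d\big(2u+\log(\alpha'^{-(4n+1)})+\log(16n)+\log\|Q(\mathbf 1)\|_\infty\big)\Big)\Big\rceil,\qquad h'=g'+1-u.$$ Then all iterations of R-DNM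 applied to $x=Q(x)$ with rounding parameter $h'$ and $g'$ iterations per nonlinear SCC (and one per linear SCC) are defined, and its (unique) result $\tilde q$ satisfies $\|q^*-\tilde q\|_\infty\le\epsilon'$. Here $g'>0$ and $h'>0$ whenever $\epsilon'<2^u$ (for larger $\epsilon'$, a negative $g'$ is read as $0$ iterations). -/

import Mathlib

open MvPolynomial

noncomputable section

namespace MPS

variable {σ : Type*}

/-- `x = P(x)` is a monotone polynomial system: every coefficient (constant terms included) of
every `P i` is non-negative. -/
def IsMPS (P : σ → MvPolynomial σ ℝ) : Prop :=
  ∀ i m, 0 ≤ (P i).coeff m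

/-- Every polynomial of the system has (multivariate) degree at most two. -/
def IsQuadratic (P : σ → MvPolynomial σ ℝ) : Prop :=
  ∀ i, (P i).totalDegree ≤ 2

/-- The map `z ↦ P(z)`. -/
def evalAt (P : σ → MvPolynomial σ ℝ) (z : σ → ℝ) : σ → ℝ :=
  fun i => eval z (P i)

/-- `q` is the least non-negative (real valued) solution of `x = P(x)`. -/
def IsLFP (P : σ → MvPolynomial σ ℝ) (q : σ → ℝ) : Prop :=
  IsLeast {a : σ → ℝ | 0 ≤ a ∧ evalAt P a = a} q

/-- The least positive coefficient (constant terms included) occurring in the system. -/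
def cMin (P : σ → MvPolynomial σ ℝ) : ℝ :=
  sInf {c : ℝ | 0 < c ∧ ∃ i m, c = (P i).coeff m}

section Newton

variable [Fintype σ] [DecidableEq σ]

/-- The Jacobian matrix `B(z)` of `P` at `z`. -/
def jacobian (P : σ → MvPolynomial σ ℝ) (z : σ → ℝ) : Matrix σ σ ℝ :=
  Matrix.of fun i j => eval z (pderiv j (P i))

/-- The Newton operator `z + (I - B(z))⁻¹ (P(z) - z)`; meaningful if `NewtonDefined P z`. -/
def newton (P : σ → MvPolynomial σ ℝ) (z : σ → ℝ) : σ → ℝ :=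
  z + Matrix.mulVec (1 - jacobian P z)⁻¹ (evalAt P z - z)

/-- The Newton operator is defined at `z`: the matrix `I - B(z)` is non-singular. -/
def NewtonDefined (P : σ → MvPolynomial σ ℝ) (z : σ → ℝ) : Prop :=
  IsUnit (1 - jacobian P z).det

/-- The greatest integer multiple of `2 ^ (-h)` that is at most `max t 0`. -/
def roundDown (h : ℤ) (t : ℝ) : ℝ :=
  (⌊max t 0 * (2 : ℝ) ^ h⌋ : ℝ) * (2 : ℝ) ^ (-h)

/-- The iterates of the rounded-down Newton method with rounding parameter `h`, started at `0`. -/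
def rnm (P : σ → MvPolynomial σ ℝ) (h : ℤ) : ℕ → σ → ℝ
  | 0 => 0
  | k + 1 => fun i => roundDown h (newton P (rnm P h k) i)

/-- `x` is the result of `k` iterations of the rounded-down Newton method, all of which are
defined. -/
def IsRNMOutput (P : σ → MvPolynomial σ ℝ) (h : ℤ) (k : ℕ) (x : σ → ℝ) : Prop :=
  (∀ m < k, NewtonDefined P (rnm P h m)) ∧ x = rnm P h k

end Newton

/-- The edge relation of the dependency graph: `x_j` appears in `P_i`. -/
def DepEdge (P : σ → MvPolynomial σ ℝ) (i j : σ) : Prop :=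
  j ∈ (P i).vars

/-- There is a (possibly empty) directed path from `i` to `j` in the dependency graph. -/
def Reach (P : σ → MvPolynomial σ ℝ) : σ → σ → Prop :=
  Relation.ReflTransGen (DepEdge P)

open Classical in
/-- The strongly connected component of `i`. -/
def scc [Fintype σ] (P : σ → MvPolynomial σ ℝ) (i : σ) : Finset σ :=
  Finset.univ.filter fun j => Reach P i j ∧ Reach P j i

/-- `S` is a strongly connected component of the dependency graph. -/
def IsSCC [Fintype σ] (P : σ → MvPolynomial σ ℝ) (S : Finset σ) : Prop :=
  ∃ i, S = scc P i

/-- The edge relation of the DAG of strongly connected components. -/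
def SCCEdge (P : σ → MvPolynomial σ ℝ) (S T : Finset σ) : Prop :=
  S ≠ T ∧ ∃ i ∈ S, ∃ j ∈ T, DepEdge P i j

/-- `l` is a directed path (listed by its nodes) in the DAG of strongly connected components. -/
def IsSCCPath [Fintype σ] (P : σ → MvPolynomial σ ℝ) (l : List (Finset σ)) : Prop :=
  (∀ S ∈ l, IsSCC P S) ∧ l.IsChain (SCCEdge P)

/-- The system `x_S = P_S(x_S, y)` in the variables `x_S`: the variables outside `S` are replaced
by their values under `y`. If `S` is a strongly connected component, then the variables outside
`S` that occur in `P_S` all lie in components below `S`. -/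
def subsystem [DecidableEq σ] (P : σ → MvPolynomial σ ℝ) (S : Finset σ) (y : σ → ℝ) :
    S → MvPolynomial S ℝ :=
  fun i => bind₁ (fun j => if hj : j ∈ S then X ⟨j, hj⟩ else C (y j)) (P i)

/-- The component `S` is linear: `x_S = P_S(x_S, q)` is a linear (affine) system in `x_S`. Here `q`
is meant to be the least fixed point. -/
def IsLinearSCC [DecidableEq σ] (P : σ → MvPolynomial σ ℝ) (q : σ → ℝ) (S : Finset σ) : Prop :=
  ∀ i, (subsystem P S q i).totalDegree ≤ 1

/-- The maximum number of components on a path of the DAG of components. -/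
def depth [Fintype σ] (P : σ → MvPolynomial σ ℝ) : ℕ :=
  sSup {k | ∃ l, IsSCCPath P l ∧ k = l.length}

open Classical in
/-- The maximum number of nonlinear components on a path of the DAG of components. -/
def nonlinearDepth [Fintype σ] [DecidableEq σ] (P : σ → MvPolynomial σ ℝ) (q : σ → ℝ) : ℕ :=
  sSup {k | ∃ l, IsSCCPath P l ∧ k = (l.filter fun S => ¬ IsLinearSCC P q S).length}

open Classical in
/-- `x` is the result of the rounded-down decomposed Newton method with rounding parameter `h`,
using `g` iterations for every nonlinear component and one for every linear component: on every
component `S`, the vector `x_S` is the result of that number of (well-defined) iterations of the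
rounded-down Newton method for the system `x_S = P_S(x_S, x_D(S))`, in which the values already
computed on the lower components have been plugged in. As the components form a DAG, this
determines `x` from the bottom up. -/
def IsRDNMOutput [Fintype σ] [DecidableEq σ] (P : σ → MvPolynomial σ ℝ) (q : σ → ℝ)
    (g : ℕ) (h : ℤ) (x : σ → ℝ) : Prop :=
  ∀ S, IsSCC P S →
    IsRNMOutput (subsystem P S x) h (if IsLinearSCC P q S then 1 else g) (fun i : S => x i)

end MPS

end

/-! Taylor expansion is exact for a quadratic system: Q(a) - Q(b) = B((a+b)/2)(a-b), and B is
affine. Components are treated one at a time. For a component S one compares x = Q_S(x, q), whose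
least fixed point is q_S (`isLFP_subsystem`), with x = Q_S(x, y), where y ≤ q are the values already
computed. The second system has the same Hessian and smaller terms of degree at most one. This is
`IsPerturbedBlock`, whose defect τ is proportional to the error δ of y.

Nonlinear S: irreducibility gives v with B(q)v ≤ v and β^|S| ≤ v ≤ 1 (`exists_vector`). If r ≤ q is
a fixed point of the lowered system, then w = q - r satisfies (I - M)w ≤ τ with M = B((q+r)/2). The
Hessian makes some entry of v - Mv at least a multiple of max w, so (I - M)⁻¹ is O(1/max w)
(`MinPrinciple.apply_le`) and (max w)² = O(τ) (`sq_sub_le`). The Newton error towards r, measured as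
a multiple of v, halves in each iteration, and rounding adds at most 2^(-h) (`rnm_nonlinear`).

Linear S: a single step solves the lowered system exactly, and the error is O(δ) + 2^(-h)
(`rnm_linear`).

Thus an error δ below S becomes O(√δ) or O(δ) on S. Read from the top down, the accuracy demanded of
lower components shrinks by a factor K at each component and is squared at each nonlinear one
(`sub_le_of_component_bound`). With e = ε'/2^u the strictest demand is (e/K^d)^(2^f), and g' is
chosen so that 2^(-g') is at most a quarter of it. `constant_bounds` shows that K = 16 n ‖Q(1)‖ 2^u
α'^(-(4n+1)) absorbs all the constants. -/

namespace MPS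

/-! ### Quadratic polynomials with non-negative coefficients -/

variable {σ : Type*}

/-- The exact Taylor identities below are additive in the polynomial, so they need checking only on
monomials of degree at most two. -/
theorem quadratic_induction {M : MvPolynomial σ ℝ → Prop} (hC : ∀ c, M (C c))
    (hX : ∀ c j, M (C c * X j)) (hXX : ∀ c j k, M (C c * (X j * X k)))
    (hadd : ∀ p r, M p → M r → M (p + r)) (p : MvPolynomial σ ℝ) (hp : p.totalDegree ≤ 2) :
    M p := by
  have key : ∀ (k : ℕ) (m : σ →₀ ℕ), Finsupp.degree m ≤ k + 1 →
      m = 0 ∨ ∃ j m', m = Finsupp.single j 1 + m' ∧ Finsupp.degree m' ≤ k := by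
    intro k m hm
    by_cases h0 : m = 0
    · exact Or.inl h0
    · right
      obtain ⟨j, hj⟩ := Finsupp.ne_iff.1 h0
      have hle : Finsupp.single j 1 ≤ m := by
        rw [Finsupp.single_le_iff]
        simp only [Finsupp.coe_zero, Pi.zero_apply] at hj
        omega
      refine ⟨j, m - Finsupp.single j 1, (add_tsub_cancel_of_le hle).symm, ?_⟩
      have h1 := congrArg Finsupp.degree (add_tsub_cancel_of_le hle)
      rw [map_add, Finsupp.degree_single] at h1
      omega
  rw [p.as_sum]
  refine Finset.sum_induction _ M hadd (by simpa using hC 0) ?_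
  intro m hm
  have h2 : Finsupp.degree m ≤ 1 + 1 := (le_totalDegree hm).trans hp
  generalize coeff m p = c
  rcases key 1 m h2 with rfl | ⟨j, m', rfl, h1⟩
  · exact hC c
  · rcases key 0 m' h1 with rfl | ⟨k, m'', rfl, h0⟩
    · have : monomial (Finsupp.single j 1 + 0) c = C c * X j := by
        rw [add_zero, C_mul_X_eq_monomial]
      rw [this]; exact hX c j
    · have h0' : m'' = 0 := by
        simpa [Finsupp.degree_eq_zero_iff] using h0
      have : monomial (Finsupp.single j 1 + (Finsupp.single k 1 + m'')) c
          = C c * (X j * X k) := by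
        rw [h0', add_zero, X, X, monomial_mul, C_mul_monomial, one_mul, mul_one]
      rw [this]; exact hXX c j k

/-- The second partial derivative of `P i` with respect to `j` and `k` (at the origin; for
quadratic systems it is constant). -/
noncomputable def hess (P : σ → MvPolynomial σ ℝ) (i j k : σ) : ℝ :=
  eval 0 (pderiv k (pderiv j (P i)))

theorem eval_pderiv_sub [Fintype σ] {p : MvPolynomial σ ℝ} (hp : p.totalDegree ≤ 2) (j : σ)
    (a b : σ → ℝ) :
    eval a (pderiv j p) - eval b (pderiv j p)
      = ∑ k, eval 0 (pderiv k (pderiv j p)) * (a k - b k) := by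
  classical
  refine quadratic_induction (M := fun p => eval a (pderiv j p) - eval b (pderiv j p)
      = ∑ k, eval 0 (pderiv k (pderiv j p)) * (a k - b k)) ?_ ?_ ?_ ?_ p hp
  · intro c; simp
  · intro c l
    by_cases h : l = j
    · subst h; simp
    · simp [pderiv_X_of_ne h]
  · intro c l m
    simp only [pderiv_mul, pderiv_X, Pi.single_apply, pderiv_C, map_add, map_mul, eval_X, eval_C,
      apply_ite (eval a), apply_ite (eval b), apply_ite (eval (0 : σ → ℝ)), map_one, map_zero]
    split_ifs <;> simp [ite_mul, mul_ite, Finset.sum_add_distrib, mul_add, add_mul] <;> ring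
  · intro p r hp hr
    simp only [map_add, add_mul, Finset.sum_add_distrib, ← hp, ← hr]
    ring

/-- The derivative along the segment from b to a is affine, so the midpoint rule integrates it
exactly. -/
theorem eval_sub_eq [Fintype σ] {p : MvPolynomial σ ℝ} (hp : p.totalDegree ≤ 2)
    (a b : σ → ℝ) :
    eval a p - eval b p
      = ∑ j, eval ((1 / 2 : ℝ) • (a + b)) (pderiv j p) * (a j - b j) := by
  classical
  refine quadratic_induction (M := fun p => eval a p - eval b p
      = ∑ j, eval ((1 / 2 : ℝ) • (a + b)) (pderiv j p) * (a j - b j)) ?_ ?_ ?_ ?_ p hp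
  · intro c; simp
  · intro c l
    simp [pderiv_X, Pi.single_apply, apply_ite (eval _), ite_mul, mul_ite]
    ring
  · intro c l m
    simp [pderiv_X, Pi.single_apply, apply_ite (eval _), ite_mul, mul_ite,
      Finset.sum_add_distrib, mul_add, add_mul]
    ring
  · intro p r hp hr
    simp only [map_add, add_mul, Finset.sum_add_distrib, ← hp, ← hr]
    ring

theorem coeff_mul_pow_le_eval [Fintype σ] {p : MvPolynomial σ ℝ} (hp : ∀ m, 0 ≤ p.coeff m)
    {s : ℝ} (hs : 0 ≤ s) {z : σ → ℝ} (hz : ∀ i, s ≤ z i) (m : σ →₀ ℕ) :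
    p.coeff m * s ^ Finsupp.degree m ≤ eval z p := by
  classical
  have hterm : ∀ d : σ →₀ ℕ, 0 ≤ coeff d p * ∏ i ∈ d.support, z i ^ d i := fun d =>
    mul_nonneg (hp d) (Finset.prod_nonneg fun i _ => pow_nonneg (hs.trans (hz i)) _)
  by_cases hm : m ∈ p.support
  · rw [eval_eq]
    refine le_trans ?_ (Finset.single_le_sum (fun d _ => hterm d) hm)
    refine mul_le_mul_of_nonneg_left ?_ (hp m)
    rw [Finsupp.degree_apply, ← Finset.prod_pow_eq_pow_sum]
    exact Finset.prod_le_prod (fun i _ => pow_nonneg hs _)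
      fun i _ => pow_le_pow_left₀ hs (hz i) _
  · rw [notMem_support_iff.1 hm, zero_mul, eval_eq]
    exact Finset.sum_nonneg fun d _ => hterm d

theorem eval_nonneg' [Fintype σ] {p : MvPolynomial σ ℝ} (hp : ∀ m, 0 ≤ p.coeff m) {z : σ → ℝ}
    (hz : 0 ≤ z) : 0 ≤ eval z p := by
  rw [eval_eq]
  exact Finset.sum_nonneg fun d _ =>
    mul_nonneg (hp d) (Finset.prod_nonneg fun i _ => pow_nonneg (hz i) _)

theorem eval_mono' [Fintype σ] {p : MvPolynomial σ ℝ} (hp : ∀ m, 0 ≤ p.coeff m) {y z : σ → ℝ}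
    (hy : 0 ≤ y) (hyz : y ≤ z) : eval y p ≤ eval z p := by
  rw [eval_eq, eval_eq]
  exact Finset.sum_le_sum fun d _ => mul_le_mul_of_nonneg_left
    (Finset.prod_le_prod (fun i _ => pow_nonneg (hy i) _)
      fun i _ => pow_le_pow_left₀ (hy i) (hyz i) _) (hp d)

theorem coeff_pderiv_nonneg {p : MvPolynomial σ ℝ} (hp : ∀ m, 0 ≤ p.coeff m) (j : σ) (m) :
    0 ≤ (pderiv j p).coeff m := by
  rw [coeff_pderiv]
  exact mul_nonneg (hp _) (by positivity)


theorem cMin_le {P : σ → MvPolynomial σ ℝ} {i : σ} {m : σ →₀ ℕ} (h : 0 < (P i).coeff m) :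
    cMin P ≤ (P i).coeff m :=
  csInf_le ⟨0, fun _ hc => hc.1.le⟩ ⟨h, i, m, rfl⟩

theorem cMin_pos [Finite σ] {P : σ → MvPolynomial σ ℝ} {i : σ} {m : σ →₀ ℕ}
    (h : 0 < (P i).coeff m) : 0 < cMin P := by
  have hfin : {c : ℝ | 0 < c ∧ ∃ i m, c = (P i).coeff m}.Finite := by
    refine Set.Finite.subset (Set.finite_iUnion fun i =>
      ((P i).support.finite_toSet.image fun m => (P i).coeff m)) ?_
    rintro c ⟨hc, i, m, rfl⟩
    exact Set.mem_iUnion.2 ⟨i, m, mem_support_iff.2 hc.ne', rfl⟩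
  have hne : {c : ℝ | 0 < c ∧ ∃ i m, c = (P i).coeff m}.Nonempty := ⟨_, h, i, m, rfl⟩
  exact (hne.csInf_mem hfin).1

theorem cMin_le_hess {P : σ → MvPolynomial σ ℝ} (hP : IsMPS P) {i j k : σ}
    (h : hess P i j k ≠ 0) : cMin P ≤ hess P i j k := by
  -- A second derivative at the origin is a coefficient times 1 if j ≠ k and times 2 if j = k, hence
  -- never below the coefficient.
  have e : hess P i j k = (P i).coeff (0 + Finsupp.single k 1 + Finsupp.single j 1)
      * ((((0 + Finsupp.single k 1 : σ →₀ ℕ) j : ℕ) : ℝ) + 1) := by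
    rw [hess, eval_zero, constantCoeff_eq, coeff_pderiv, coeff_pderiv]
    simp
  have h0 : (P i).coeff (0 + Finsupp.single k 1 + Finsupp.single j 1) ≠ 0 := by
    intro h0; rw [e, h0, zero_mul] at h; exact h rfl
  have hpos := lt_of_le_of_ne (hP i _) h0.symm
  refine (cMin_le hpos).trans ?_
  rw [e]
  refine le_mul_of_one_le_right hpos.le ?_
  have : (0 : ℝ) ≤ (((0 + Finsupp.single k 1 : σ →₀ ℕ) j : ℕ) : ℝ) := Nat.cast_nonneg _
  linarith

theorem hess_nonneg {P : σ → MvPolynomial σ ℝ} (hP : IsMPS P) (i j k : σ) :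
    0 ≤ hess P i j k := by
  rw [hess, eval_zero, constantCoeff_eq]
  exact coeff_pderiv_nonneg (coeff_pderiv_nonneg (hP i) j) k 0

theorem jacobian_eq_zero {P : σ → MvPolynomial σ ℝ} {i j : σ} (h : j ∉ (P i).vars) (z : σ → ℝ) : jacobian P z i j = 0 := by
  simp [jacobian, pderiv_eq_zero_of_notMem_vars h]

/-- Meant for the constant terms of a subsystem: there z vanishes on the component and equals the
least fixed point elsewhere, and a non-zero value needs a monomial that avoids the zeros. -/
theorem cMin_mul_sq_le_evalAt {P : σ → MvPolynomial σ ℝ} (hP : IsMPS P) (hP2 : IsQuadratic P) {i : σ} {s : ℝ} (hs : 0 ≤ s)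
    (hs1 : s ≤ 1) {z : σ → ℝ} (hz : ∀ j, z j = 0 ∨ s ≤ z j) (h : evalAt P z i ≠ 0) :
    cMin P * s ^ 2 ≤ evalAt P z i := by
  have hz0 : 0 ≤ z := fun j => (hz j).elim (fun h => h.ge) hs.trans
  have hterm : ∀ d : σ →₀ ℕ, 0 ≤ coeff d (P i) * ∏ j ∈ d.support, z j ^ d j := fun d =>
    mul_nonneg (hP i d) (Finset.prod_nonneg fun j _ => pow_nonneg (hz0 j) _)
  unfold evalAt at h ⊢
  rw [eval_eq] at h ⊢
  obtain ⟨d, hd, hne⟩ := Finset.exists_ne_zero_of_sum_ne_zero h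
  refine le_trans ?_ (Finset.single_le_sum (fun d _ => hterm d) hd)
  have hpos : 0 < (P i).coeff d := lt_of_le_of_ne (hP i d) (mem_support_iff.1 hd).symm
  refine mul_le_mul (cMin_le hpos) ?_ (by positivity) hpos.le
  calc s ^ 2 ≤ s ^ Finsupp.degree d :=
        pow_le_pow_of_le_one hs hs1 ((le_totalDegree hd).trans (hP2 i))
    _ = ∏ j ∈ d.support, s ^ d j := by
        rw [Finsupp.degree_apply, Finset.prod_pow_eq_pow_sum]
    _ ≤ ∏ j ∈ d.support, z j ^ d j := by
        refine Finset.prod_le_prod (fun j _ => pow_nonneg hs _) fun j hj => ?_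
        rcases hz j with h0 | h1
        · exfalso
          refine hne (mul_eq_zero_of_right _ (Finset.prod_eq_zero hj ?_))
          rw [h0, zero_pow (Finsupp.mem_support_iff.1 hj)]
        · exact pow_le_pow_left₀ hs h1 _

theorem continuous_evalAt (P : σ → MvPolynomial σ ℝ) : Continuous (evalAt P) :=
  continuous_pi fun i => MvPolynomial.continuous_eval (P i)

theorem continuous_jacobian_apply (P : σ → MvPolynomial σ ℝ) (i j : σ) :
    Continuous fun z => jacobian P z i j :=
  MvPolynomial.continuous_eval (pderiv j (P i))

section System

variable [Fintype σ] {P : σ → MvPolynomial σ ℝ}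

theorem jacobian_nonneg (hP : IsMPS P) {z : σ → ℝ} (hz : 0 ≤ z) (i j : σ) :
    0 ≤ jacobian P z i j :=
  eval_nonneg' (coeff_pderiv_nonneg (hP i) j) hz

theorem jacobian_mono (hP : IsMPS P) {y z : σ → ℝ} (hy : 0 ≤ y) (hyz : y ≤ z) (i j : σ) :
    jacobian P y i j ≤ jacobian P z i j :=
  eval_mono' (coeff_pderiv_nonneg (hP i) j) hy hyz

theorem evalAt_nonneg (hP : IsMPS P) {z : σ → ℝ} (hz : 0 ≤ z) : 0 ≤ evalAt P z :=
  fun i => eval_nonneg' (hP i) hz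

theorem evalAt_mono (hP : IsMPS P) {y z : σ → ℝ} (hy : 0 ≤ y) (hyz : y ≤ z) :
    evalAt P y ≤ evalAt P z :=
  fun i => eval_mono' (hP i) hy hyz

theorem jacobian_sub (hP2 : IsQuadratic P) (a b : σ → ℝ) (i j : σ) :
    jacobian P a i j - jacobian P b i j = ∑ k, hess P i j k * (a k - b k) :=
  eval_pderiv_sub (hP2 i) j a b

theorem evalAt_sub (hP2 : IsQuadratic P) (a b : σ → ℝ) (i : σ) :
    evalAt P a i - evalAt P b i
      = ∑ j, jacobian P ((1 / 2 : ℝ) • (a + b)) i j * (a j - b j) :=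
  eval_sub_eq (hP2 i) a b

theorem cMin_mul_le_jacobian (hP : IsMPS P) (hP2 : IsQuadratic P) {i j : σ}
    (h : j ∈ (P i).vars) {s : ℝ} (hs : 0 ≤ s) (hs1 : s ≤ 1) {z : σ → ℝ} (hz : ∀ i, s ≤ z i) :
    cMin P * s ≤ jacobian P z i j := by
  obtain ⟨m, hm, hj⟩ := (mem_vars_iff_mem_support j).1 h
  have hle : Finsupp.single j 1 ≤ m := by
    rw [Finsupp.single_le_iff]
    have := Finsupp.mem_support_iff.1 hj
    omega
  have e := tsub_add_cancel_of_le hle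
  set m' := m - Finsupp.single j 1
  have hdeg : Finsupp.degree m' ≤ 1 := by
    have h1 : Finsupp.degree m ≤ 2 := (le_totalDegree hm).trans (hP2 i)
    rw [← e, map_add, Finsupp.degree_single] at h1
    omega
  have hpos : 0 < (P i).coeff m := lt_of_le_of_ne (hP i m) (mem_support_iff.1 hm).symm
  refine le_trans ?_ (coeff_mul_pow_le_eval (coeff_pderiv_nonneg (hP i) j) hs hz m')
  rw [coeff_pderiv, e]
  refine mul_le_mul ?_ ?_ hs (by positivity)
  · refine (cMin_le hpos).trans (le_mul_of_one_le_right hpos.le ?_)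
    have : (0 : ℝ) ≤ (m' j : ℝ) := Nat.cast_nonneg _
    linarith
  · calc s = s ^ 1 := (pow_one s).symm
      _ ≤ s ^ Finsupp.degree m' := pow_le_pow_of_le_one hs hs1 hdeg

/-- The Jacobian is affine with non-negative value at the origin, and only its linear part is scaled
by U. -/
theorem jacobian_smul_le (hP : IsMPS P) (hP2 : IsQuadratic P) {U : ℝ} (hU : 1 ≤ U) (z : σ → ℝ)
    (i j : σ) : jacobian P (U • z) i j ≤ U * jacobian P z i j := by
  have h1 := jacobian_sub hP2 (U • z) 0 i j
  have h2 := jacobian_sub hP2 z 0 i j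
  have h0 := jacobian_nonneg hP (le_refl (0 : σ → ℝ)) i j
  have h3 : ∑ k, hess P i j k * ((U • z) k - (0 : σ → ℝ) k)
      = U * ∑ k, hess P i j k * (z k - (0 : σ → ℝ) k) := by
    rw [Finset.mul_sum]
    refine Finset.sum_congr rfl fun k _ => ?_
    simp only [Pi.smul_apply, smul_eq_mul, Pi.zero_apply]
    ring
  rw [h3, ← h2] at h1
  nlinarith

theorem half_mul_jacobian_le (hP : IsMPS P) (hP2 : IsQuadratic P) (z : σ → ℝ) (i j : σ) :
    1 / 2 * jacobian P z i j ≤ jacobian P ((1 / 2 : ℝ) • z) i j := by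
  have h := jacobian_smul_le hP hP2 (U := 2) (by norm_num) ((1 / 2 : ℝ) • z) i j
  rw [smul_smul] at h
  norm_num at h ⊢
  linarith

/-- B(z) ≤ U B(1) ≤ 2U B(1/2) entrywise, and by the midpoint formula the i-th row of B(1/2) sums to
P_i(1) - P_i(0). -/
theorem sum_jacobian_le (hP : IsMPS P) (hP2 : IsQuadratic P) {U : ℝ} (hU : 1 ≤ U) {z : σ → ℝ}
    (hz : 0 ≤ z) (hzU : ∀ i, z i ≤ U) (i : σ) :
    ∑ j, jacobian P z i j ≤ 2 * U * evalAt P 1 i := by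
  have h1 : ∀ j, jacobian P z i j ≤ U * (2 * jacobian P ((1 / 2 : ℝ) • 1) i j) := by
    intro j
    calc jacobian P z i j ≤ jacobian P (U • 1) i j :=
          jacobian_mono hP hz (fun k => by simpa using hzU k) i j
      _ ≤ U * jacobian P 1 i j := jacobian_smul_le hP hP2 hU 1 i j
      _ ≤ _ := by
        have := half_mul_jacobian_le hP hP2 1 i j
        nlinarith
  have h2 := evalAt_sub hP2 1 0 i
  have h3 := evalAt_nonneg hP (le_refl (0 : σ → ℝ)) i
  simp only [Pi.zero_apply, Pi.one_apply, sub_zero, mul_one, add_zero] at h2 h3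
  calc ∑ j, jacobian P z i j ≤ ∑ j, U * (2 * jacobian P ((1 / 2 : ℝ) • 1) i j) :=
        Finset.sum_le_sum fun j _ => h1 j
    _ = 2 * U * ∑ j, jacobian P ((1 / 2 : ℝ) • 1) i j := by
        rw [← Finset.mul_sum, ← Finset.mul_sum]; ring
    _ ≤ _ := by
        rw [← h2]
        nlinarith

theorem evalAt_le_sq_mul (hP : IsMPS P) (hP2 : IsQuadratic P) {U : ℝ} (hU : 1 ≤ U) {z : σ → ℝ}
    (hz : 0 ≤ z) (hzU : ∀ i, z i ≤ U) (i : σ) :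
    evalAt P z i ≤ U ^ 2 * evalAt P 1 i := by
  have h0 := evalAt_mono hP hz (z := U • 1) (fun k => by simpa using hzU k) i
  have h1 := evalAt_sub hP2 (U • 1) 0 i
  have h2 := evalAt_sub hP2 1 0 i
  have h3 := evalAt_nonneg hP (le_refl (0 : σ → ℝ)) i
  have h4 : evalAt P (U • 1) i - evalAt P 0 i ≤ U ^ 2 * (evalAt P 1 i - evalAt P 0 i) := by
    rw [h1, h2, Finset.mul_sum]
    refine Finset.sum_le_sum fun j _ => ?_
    have h5 := jacobian_smul_le hP hP2 hU ((1 / 2 : ℝ) • 1) i j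
    rw [smul_comm] at h5
    simp only [add_zero, Pi.smul_apply, Pi.one_apply, Pi.zero_apply, smul_eq_mul, sub_zero,
      mul_one]
    nlinarith
  have h5 : 0 ≤ (U ^ 2 - 1) * evalAt P 0 i := mul_nonneg (by nlinarith) h3
  linarith

end System

end MPS

/-! ### Irreducible non-negative matrices -/

namespace MPS

open Matrix

section Matrices

variable {ι : Type*} [Fintype ι] {E : ι → ι → Prop} {M M₀ : Matrix ι ι ℝ}

omit [Fintype ι] in
theorem exists_crossing_edge {p : ι → Prop} {i j : ι} (h : Relation.ReflTransGen E i j)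
    (hi : ¬ p i) (hj : p j) : ∃ a b, E a b ∧ ¬ p a ∧ p b := by
  induction h with
  | refl => exact absurd hj hi
  | @tail b c _ hbc ih =>
    by_cases hb : p b
    · exact ih hb
    · exact ⟨b, c, hbc, hb, hj⟩

omit [Fintype ι] in
theorem forall_of_edge_closed (hE : ∀ i j, Relation.ReflTransGen E i j) {p : ι → Prop}
    (hp : ∀ a b, E a b → p a → p b) {i : ι} (hi : p i) (j : ι) : p j := by
  by_contra hj
  obtain ⟨a, b, hab, ha, hb⟩ :=
    exists_crossing_edge (p := fun k => ¬ p k) (hE i j) (not_not.2 hi) hj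
  exact hb (hp a b hab (not_not.1 ha))

/-- A nonnegative supersolution of an irreducible nonnegative matrix has comparable entries. -/
theorem pow_card_mul_le_of_mulVec_le (hE : ∀ i j, Relation.ReflTransGen E i j) {β : ℝ}
    (hβ : 0 ≤ β) (hβ1 : β ≤ 1) (hM : ∀ i j, 0 ≤ M i j) (hME : ∀ i j, E i j → β ≤ M i j)
    {v : ι → ℝ} (hv : 0 ≤ v) (hMv : M *ᵥ v ≤ v) (i j : ι) :
    β ^ Fintype.card ι * v j ≤ v i := by
  classical
  let W : ℕ → Finset ι := fun k => Finset.univ.filter fun i => β ^ k * v j ≤ v i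
  have hW : ∀ k i, i ∈ W k ↔ β ^ k * v j ≤ v i := fun k i => by simp [W]
  -- As long as `W k` is not everything, irreducibility gives an edge from outside into it. That
  -- edge carries the lower bound to a new index at the cost of a factor β.
  have key : ∀ k, (∀ i, i ∈ W k) ∨ k + 1 ≤ (W k).card := by
    intro k
    induction k with
    | zero => exact Or.inr (Finset.card_pos.2 ⟨j, (hW 0 j).2 (by simp)⟩)
    | succ k ih =>
      have hsub : W k ⊆ W (k + 1) := fun i hi => (hW _ _).2 (le_trans
        (mul_le_mul_of_nonneg_right (pow_le_pow_of_le_one hβ hβ1 k.le_succ) (hv j))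
        ((hW _ _).1 hi))
      by_cases hall : ∀ i, i ∈ W k
      · exact Or.inl fun i => hsub (hall i)
      · right
        obtain ⟨i, hi⟩ := not_forall.1 hall
        have hj : j ∈ W k := (hW k j).2
          (mul_le_of_le_one_left (hv j) (pow_le_one₀ hβ hβ1))
        obtain ⟨a, b, hab, ha, hb⟩ := exists_crossing_edge (p := (· ∈ W k)) (hE i j) hi hj
        have ha' : a ∈ W (k + 1) := by
          rw [hW]
          calc β ^ (k + 1) * v j = β * (β ^ k * v j) := by ring
            _ ≤ M a b * v b := mul_le_mul (hME a b hab) ((hW _ _).1 hb)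
                (mul_nonneg (pow_nonneg hβ _) (hv j)) (hM a b)
            _ ≤ (M *ᵥ v) a := Finset.single_le_sum (f := fun b => M a b * v b)
                (fun b _ => mul_nonneg (hM a b) (hv b)) (Finset.mem_univ b)
            _ ≤ v a := hMv a
        have : (W k).card < (W (k + 1)).card :=
          Finset.card_lt_card (Finset.ssubset_iff_subset_ne.2 ⟨hsub, fun h => ha (h ▸ ha')⟩)
        have := ih.resolve_left hall
        omega
  rcases key (Fintype.card ι) with h | h
  · exact (hW _ _).1 (h i)
  · have := Finset.card_le_univ (W (Fintype.card ι))
    omega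

/-- The minimum principle for `1 - M`: supersolutions are nonnegative. -/
def MinPrinciple (M : Matrix ι ι ℝ) : Prop :=
  ∀ x : ι → ℝ, M *ᵥ x ≤ x → 0 ≤ x

/-- A Perron–Frobenius argument without eigenvalues. If the least ratio l = min x/v is negative,
contact x = l v spreads along edges to all indices, which forces M = M₀ and M₀ v = v. -/
theorem MinPrinciple.of_le (hE : ∀ i j, Relation.ReflTransGen E i j) (hM : ∀ i j, 0 ≤ M i j)
    (hMM₀ : ∀ i j, M i j ≤ M₀ i j) (hME : ∀ i j, E i j → 0 < M₀ i j) {v : ι → ℝ}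
    (hv : ∀ i, 0 < v i) (hv' : M₀ *ᵥ v ≤ v) (hne : M ≠ M₀ ∨ M₀ *ᵥ v ≠ v) : MinPrinciple M := by
  intro x hx
  by_contra hneg
  obtain ⟨i₁, hi₁⟩ : ∃ i, x i < 0 := by
    by_contra! h
    exact hneg h
  obtain ⟨i₀, -, hi₀⟩ := Finset.exists_min_image Finset.univ (fun i => x i / v i) ⟨i₁, by simp⟩
  set l := x i₀ / v i₀ with hl
  have hl0 : l < 0 := (hi₀ i₁ (by simp)).trans_lt (div_neg_of_neg_of_pos hi₁ (hv i₁))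
  have hxl : ∀ i, l * v i ≤ x i := fun i => (le_div_iff₀ (hv i)).1 (hi₀ i (by simp))
  -- At a contact index, x ≥ Mx ≥ l Mv ≥ l M₀v ≥ l v = x, the last two inequalities because l < 0.
  -- So each of them is an equality, term by term.
  have key : ∀ i, x i = l * v i →
      (∀ j, M i j * (x j - l * v j) = 0) ∧ (∀ j, (M₀ i j - M i j) * v j = 0)
        ∧ (M₀ *ᵥ v) i = v i := by
    intro i hi
    have h1 : ∑ j, M i j * x j ≤ x i := hx i
    have h2 : ∑ j, M₀ i j * v j ≤ v i := hv' i
    have n1 : ∀ j ∈ Finset.univ, 0 ≤ M i j * (x j - l * v j) := fun j _ =>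
      mul_nonneg (hM i j) (sub_nonneg.2 (hxl j))
    have n2 : ∀ j ∈ Finset.univ, 0 ≤ (M₀ i j - M i j) * v j := fun j _ =>
      mul_nonneg (sub_nonneg.2 (hMM₀ i j)) (hv j).le
    have s1 : ∑ j, M i j * (x j - l * v j) = ∑ j, M i j * x j - l * ∑ j, M i j * v j := by
      rw [Finset.mul_sum, ← Finset.sum_sub_distrib]
      exact Finset.sum_congr rfl fun j _ => by ring
    have s2 : ∑ j, (M₀ i j - M i j) * v j = ∑ j, M₀ i j * v j - ∑ j, M i j * v j := by
      rw [← Finset.sum_sub_distrib]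
      exact Finset.sum_congr rfl fun j _ => by ring
    have p1 := Finset.sum_nonneg n1
    have p2 := Finset.sum_nonneg n2
    have z2 : ∑ j, (M₀ i j - M i j) * v j = 0 := by nlinarith
    have z3 : ∑ j, M₀ i j * v j = v i := by nlinarith
    have z1 : ∑ j, M i j * (x j - l * v j) = 0 := by
      rw [s2] at z2
      rw [s1] at p1 ⊢
      have : ∑ j, M i j * v j = v i := by linarith
      rw [this] at p1 ⊢
      linarith
    exact ⟨fun j => (Finset.sum_eq_zero_iff_of_nonneg n1).1 z1 j (by simp),
      fun j => (Finset.sum_eq_zero_iff_of_nonneg n2).1 z2 j (by simp), z3⟩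
  have hall : ∀ i, x i = l * v i := by
    refine forall_of_edge_closed hE (p := fun i => x i = l * v i) ?_
      (i := i₀) (div_mul_cancel₀ _ (hv i₀).ne').symm
    intro a b hab ha
    obtain ⟨h1, h2, -⟩ := key a ha
    have e : M₀ a b - M a b = 0 := (mul_eq_zero.1 (h2 b)).resolve_right (hv b).ne'
    have := hME a b hab
    exact sub_eq_zero.1 ((mul_eq_zero.1 (h1 b)).resolve_left (by linarith))
  rcases hne with h | h
  · refine h (Matrix.ext fun i j => ?_)
    have := (mul_eq_zero.1 ((key i (hall i)).2.1 j)).resolve_right (hv j).ne'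
    linarith
  · exact h (funext fun i => (key i (hall i)).2.2)

theorem MinPrinciple.le (h : MinPrinciple M) {x y : ι → ℝ}
    (hxy : ∀ i, x i - (M *ᵥ x) i ≤ y i - (M *ᵥ y) i) : x ≤ y := by
  have := h (y - x) fun i => by
    rw [mulVec_sub]
    have := hxy i
    simp only [Pi.sub_apply]
    linarith
  exact fun i => sub_nonneg.1 (this i)

variable [DecidableEq ι]

theorem MinPrinciple.isUnit_det (h : MinPrinciple M) : IsUnit (1 - M).det := by
  rw [← Matrix.isUnit_iff_isUnit_det, ← Matrix.mulVec_injective_iff_isUnit]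
  intro x y hxy
  have hxy' : ∀ i, x i - (M *ᵥ x) i = y i - (M *ᵥ y) i := fun i => by
    have := congrFun hxy i
    simpa [sub_mulVec] using this
  exact le_antisymm (h.le fun i => (hxy' i).le) (h.le fun i => (hxy' i).ge)

theorem MinPrinciple.inv_nonneg (h : MinPrinciple M) (i j : ι) : 0 ≤ (1 - M)⁻¹ i j := by
  have h1 : (1 - M) *ᵥ ((1 - M)⁻¹ *ᵥ Pi.single j 1) = Pi.single j 1 := by
    rw [mulVec_mulVec, mul_nonsing_inv _ h.isUnit_det, one_mulVec]
  have h2 := h ((1 - M)⁻¹ *ᵥ Pi.single j 1) fun k => by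
    have := congrFun h1 k
    rw [sub_mulVec, one_mulVec, Pi.sub_apply] at this
    have h0 : (0 : ℝ) ≤ (Pi.single j 1 : ι → ℝ) k := by
      rw [Pi.single_apply]; split_ifs <;> norm_num
    linarith
  simpa [mulVec_single] using h2 i

theorem MinPrinciple.eq_inv_mulVec (h : MinPrinciple M) (x : ι → ℝ) :
    x = (1 - M)⁻¹ *ᵥ (x - M *ᵥ x) := by
  have : x - M *ᵥ x = (1 - M) *ᵥ x := by rw [sub_mulVec, one_mulVec]
  rw [this, mulVec_mulVec, nonsing_inv_mul _ h.isUnit_det, one_mulVec]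

/-- A bound on the resolvent of an irreducible matrix obtained from one supersolution that is
strict at a single index. -/
theorem MinPrinciple.apply_le (h : MinPrinciple M) (hE : ∀ i j, Relation.ReflTransGen E i j)
    {β : ℝ} (hβ : 0 < β) (hβ1 : β ≤ 1) (hM : ∀ i j, 0 ≤ M i j) (hME : ∀ i j, E i j → β ≤ M i j)
    {p : ι → ℝ} {i : ι} {s U : ℝ} (hs : 0 < s) (hp : M *ᵥ p ≤ p) (hpi : s ≤ p i - (M *ᵥ p) i)
    (hpU : ∀ j, p j ≤ U) {w : ι → ℝ} {τ : ℝ} (hτ : 0 ≤ τ) (hw : ∀ j, w j - (M *ᵥ w) j ≤ τ)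
    (j : ι) : w j ≤ Fintype.card ι * (U / s / β ^ Fintype.card ι * τ) := by
  set N := (1 - M)⁻¹ with hN
  have hNn : ∀ a b, 0 ≤ N a b := h.inv_nonneg
  -- Since p = N(p - Mp) with p - Mp ≥ 0, the single strict index i bounds column i of the resolvent
  -- N.
  have h1 : N j i * s ≤ U := by
    refine le_trans ?_ (hpU j)
    rw [h.eq_inv_mulVec p]
    refine le_trans (mul_le_mul_of_nonneg_left hpi (hNn j i)) ?_
    exact Finset.single_le_sum (f := fun b => N j b * (p - M *ᵥ p) b)
      (fun b _ => mul_nonneg (hNn j b) (sub_nonneg.2 (hp b))) (Finset.mem_univ i)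
  have hE' : ∀ a b, Relation.ReflTransGen (Function.swap E) a b := fun a b =>
    Relation.reflTransGen_swap.2 (hE b a)
  -- From N(1 - M) = 1, the rows of N are supersolutions of the transpose. Their entries are
  -- therefore comparable, and the bound on column i extends to all columns.
  have hrow : Mᵀ *ᵥ (N j) ≤ N j := by
    intro b
    have e : N * (1 - M) = 1 := nonsing_inv_mul _ h.isUnit_det
    rw [mul_sub, mul_one] at e
    have e' := congrFun (congrFun e j) b
    rw [Matrix.sub_apply, Matrix.mul_apply] at e'
    have h0 : (0 : ℝ) ≤ (1 : Matrix ι ι ℝ) j b := by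
      rw [one_apply]; split_ifs <;> norm_num
    have e2 : (Mᵀ *ᵥ (N j)) b = ∑ a, N j a * M a b :=
      Finset.sum_congr rfl fun a _ => mul_comm _ _
    rw [e2]
    linarith
  have h2 : ∀ l, N j l ≤ U / s / β ^ Fintype.card ι := by
    intro l
    have := pow_card_mul_le_of_mulVec_le (M := Mᵀ) hE' hβ.le hβ1 (fun a b => hM b a)
      (fun a b hab => hME b a hab) (hNn j) hrow i l
    rw [le_div_iff₀ (pow_pos hβ _), le_div_iff₀ hs]
    nlinarith
  calc w j = (N *ᵥ (w - M *ᵥ w)) j := congrFun (h.eq_inv_mulVec w) j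
    _ = ∑ l, N j l * (w - M *ᵥ w) l := rfl
    _ ≤ ∑ _l : ι, U / s / β ^ Fintype.card ι * τ := Finset.sum_le_sum fun l _ =>
        (mul_le_mul_of_nonneg_left (hw l) (hNn j l)).trans
          (mul_le_mul_of_nonneg_right (h2 l) hτ)
    _ = _ := by simp

end Matrices

end MPS

/-! ### Rounding, value iteration and perturbed blocks -/

namespace MPS

open Matrix Filter Topology

section Rounding

theorem roundDown_nonneg (h : ℤ) (t : ℝ) : 0 ≤ roundDown h t := by
  have : (0 : ℤ) ≤ ⌊max t 0 * (2 : ℝ) ^ h⌋ := Int.floor_nonneg.2 (by positivity)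
  have : (0 : ℝ) ≤ (⌊max t 0 * (2 : ℝ) ^ h⌋ : ℝ) := by exact_mod_cast this
  unfold roundDown
  positivity

theorem roundDown_le (h : ℤ) (t : ℝ) : roundDown h t ≤ max t 0 := by
  unfold roundDown
  have := Int.floor_le (max t 0 * (2 : ℝ) ^ h)
  rw [_root_.zpow_neg, ← div_eq_mul_inv, div_le_iff₀ (by positivity)]
  exact this

theorem sub_le_roundDown (h : ℤ) (t : ℝ) : t - (2 : ℝ) ^ (-h) ≤ roundDown h t := by
  unfold roundDown
  have h1 := (Int.lt_floor_add_one (max t 0 * (2 : ℝ) ^ h)).le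
  have h2 : (0 : ℝ) < (2 : ℝ) ^ h := by positivity
  have h3 : (2 : ℝ) ^ h * (2 : ℝ) ^ (-h) = 1 := by
    rw [_root_.zpow_neg]; exact mul_inv_cancel₀ h2.ne'
  have h4 := mul_le_mul_of_nonneg_right h1 (by positivity : (0 : ℝ) ≤ (2 : ℝ) ^ (-h))
  rw [mul_assoc, h3, mul_one, add_mul, one_mul] at h4
  have := le_max_left t 0
  linarith

end Rounding

variable {ι : Type*} [Fintype ι]

/-- Value iteration from 0 increases and stays below z; by continuity its limit is a fixed point. -/
theorem exists_fixedPoint_tendsto {P : ι → MvPolynomial ι ℝ} (hP : IsMPS P) {z : ι → ℝ}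
    (hz : 0 ≤ z) (hPz : evalAt P z ≤ z) :
    ∃ r, 0 ≤ r ∧ r ≤ z ∧ evalAt P r = r ∧
      Tendsto (fun k => (evalAt P)^[k] 0) atTop (𝓝 r) ∧
      ∀ k, 0 ≤ (evalAt P)^[k] 0 ∧ (evalAt P)^[k] 0 ≤ (evalAt P)^[k + 1] 0 := by
  set x : ℕ → ι → ℝ := fun k => (evalAt P)^[k] 0 with hx
  have hs : ∀ k, x (k + 1) = evalAt P (x k) := fun k => Function.iterate_succ_apply' _ _ _
  have h0 : ∀ k, 0 ≤ x k ∧ x k ≤ z ∧ x k ≤ x (k + 1) := by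
    intro k
    induction k with
    | zero => exact ⟨le_rfl, hz, by rw [hs]; exact evalAt_nonneg hP le_rfl⟩
    | succ k ih =>
      obtain ⟨i1, i2, i3⟩ := ih
      have p1 : 0 ≤ x (k + 1) := i1.trans i3
      refine ⟨p1, ?_, ?_⟩
      · rw [hs]; exact (evalAt_mono hP i1 i2).trans hPz
      · rw [hs (k + 1), hs k, ← hs k]
        exact (hs k).le.trans (evalAt_mono hP i1 i3)
  have hmono : Monotone x := monotone_nat_of_le_succ fun k => (h0 k).2.2
  have hlim : Tendsto x atTop (𝓝 fun i => ⨆ k, x k i) := tendsto_pi_nhds.2 fun i =>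
    tendsto_atTop_ciSup (fun a b hab => hmono hab i)
      ⟨z i, by rintro _ ⟨k, rfl⟩; exact (h0 k).2.1 i⟩
  refine ⟨_, ?_, ?_, ?_, hlim, fun k => ⟨(h0 k).1, (h0 k).2.2⟩⟩
  · exact ge_of_tendsto' hlim fun k => (h0 k).1
  · exact le_of_tendsto' hlim fun k => (h0 k).2.1
  · have h1 := ((continuous_evalAt P).tendsto _).comp hlim
    have h2 := (tendsto_add_atTop_iff_nat 1).2 hlim
    refine tendsto_nhds_unique h1 (h2.congr fun k => ?_)
    exact hs k

/-- `x = P(x)` is an irreducible quadratic system with least fixed point `q`, and `x = P'(x)` is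
obtained from it by decreasing the coefficients of degree at most one, by a total amount of at
most `τ` on the box below `q`. -/
structure IsPerturbedBlock (P P' : ι → MvPolynomial ι ℝ) (q : ι → ℝ) (E : ι → ι → Prop)
    (β U τ : ℝ) : Prop where
  mps : IsMPS P
  quad : IsQuadratic P
  mps' : IsMPS P'
  quad' : IsQuadratic P'
  hess_eq : ∀ i j k, hess P' i j k = hess P i j k
  jac_le : ∀ z, 0 ≤ z → ∀ i j, jacobian P' z i j ≤ jacobian P z i j
  eval_le : ∀ z, 0 ≤ z → z ≤ q → ∀ i, evalAt P' z i ≤ evalAt P z i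
  eval_ge : ∀ z, 0 ≤ z → z ≤ q → ∀ i, evalAt P z i - evalAt P' z i ≤ τ
  lfp : IsLFP P q
  q_pos : ∀ i, 0 < q i
  q_le : ∀ i, q i ≤ U
  irred : ∀ i j, Relation.ReflTransGen E i j
  β_pos : 0 < β
  β_le : β ≤ 1
  edge : ∀ i j, E i j → β ≤ jacobian P ((1 / 2 : ℝ) • q) i j
  edge_of_hess : ∀ i j k, hess P i j k ≠ 0 → E i j
  hess_ge : ∀ i j k, hess P i j k ≠ 0 → β ≤ hess P i j k
  const_ge : ∀ i, evalAt P 0 i ≠ 0 → β ^ 2 ≤ evalAt P 0 i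

namespace IsPerturbedBlock

variable {P P' : ι → MvPolynomial ι ℝ} {q : ι → ℝ} {E : ι → ι → Prop} {β U τ : ℝ}

omit [Fintype ι] in
theorem q_nonneg (hB : IsPerturbedBlock P P' q E β U τ) : 0 ≤ q := fun i => (hB.q_pos i).le

omit [Fintype ι] in
theorem τ_nonneg [Nonempty ι] (hB : IsPerturbedBlock P P' q E β U τ) : 0 ≤ τ := by
  obtain ⟨i⟩ := ‹Nonempty ι›
  have h1 := hB.eval_le q hB.q_nonneg le_rfl i
  have h2 := hB.eval_ge q hB.q_nonneg le_rfl i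
  linarith

theorem edge_le (hB : IsPerturbedBlock P P' q E β U τ) {z : ι → ℝ}
    (hz : (1 / 2 : ℝ) • q ≤ z) {i j : ι} (h : E i j) : β ≤ jacobian P z i j :=
  (hB.edge i j h).trans (jacobian_mono hB.mps
    (smul_nonneg (by norm_num) hB.q_nonneg) hz i j)

omit [Fintype ι] in
theorem half_smul_le_mid {q x : ι → ℝ} (hx : 0 ≤ x) :
    (1 / 2 : ℝ) • q ≤ (1 / 2 : ℝ) • (q + x) :=
  smul_le_smul_of_nonneg_left (le_add_of_nonneg_right hx) (by norm_num)

omit [Fintype ι] in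
theorem le_mid {q x : ι → ℝ} (hx : x ≤ q) : x ≤ (1 / 2 : ℝ) • (q + x) := fun i => by
  have := hx i
  simp only [Pi.smul_apply, Pi.add_apply, smul_eq_mul]
  linarith

omit [Fintype ι] in
theorem mid_le {q x : ι → ℝ} (hx : x ≤ q) : (1 / 2 : ℝ) • (q + x) ≤ q := fun i => by
  have := hx i
  simp only [Pi.smul_apply, Pi.add_apply, smul_eq_mul]
  linarith

omit [Fintype ι] in
theorem half_le (hB : IsPerturbedBlock P P' q E β U τ) : (1 / 2 : ℝ) • q ≤ q := by
  simpa using mid_le (x := 0) hB.q_nonneg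

omit [Fintype ι] in
theorem exists_edge (hB : IsPerturbedBlock P P' q E β U τ) {i₀ j₀ : ι} (h : E i₀ j₀) (i : ι) :
    ∃ j, E i j := by
  rcases Relation.ReflTransGen.cases_head (hB.irred i i₀) with rfl | ⟨j, hj, -⟩
  · exact ⟨j₀, h⟩
  · exact ⟨j, hj⟩

/-- The Jacobian at the least fixed point of an irreducible system has spectral radius at most
one, witnessed by a supersolution that is a limit of normalized errors of value iteration. -/
theorem exists_vector (hB : IsPerturbedBlock P P' q E β U τ) {i₀ j₀ : ι} (hE₀ : E i₀ j₀) :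
    ∃ v : ι → ℝ, (∀ i, v i ≤ 1) ∧ (∀ i, β ^ Fintype.card ι ≤ v i) ∧
      jacobian P q *ᵥ v ≤ v := by
  obtain ⟨r, hr0, hrq, hr, hlim, hx⟩ :=
    exists_fixedPoint_tendsto hB.mps hB.q_nonneg hB.lfp.1.2.le
  obtain rfl : r = q := le_antisymm hrq (hB.lfp.2 ⟨hr0, hr⟩)
  set x : ℕ → ι → ℝ := fun k => (evalAt P)^[k] 0
  have hs : ∀ k, x (k + 1) = evalAt P (x k) := fun k => Function.iterate_succ_apply' _ _ _
  have hmono : Monotone x := monotone_nat_of_le_succ fun k => (hx k).2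
  have hxr : ∀ k, x k ≤ r := fun k => hmono.ge_of_tendsto hlim k
  have hdiff : ∀ k i, r i - x (k + 1) i
      = ∑ j, jacobian P ((1 / 2 : ℝ) • (r + x k)) i j * (r j - x k j) := by
    intro k i
    rw [← evalAt_sub hB.quad, hs, hr]
  have hterm : ∀ k i j, 0 ≤ jacobian P ((1 / 2 : ℝ) • (r + x k)) i j * (r j - x k j) :=
    fun k i j => mul_nonneg (jacobian_nonneg hB.mps
      (smul_nonneg (by norm_num) (add_nonneg hr0 (hx k).1)) i j) (sub_nonneg.2 (hxr k j))
  -- Strictness makes the normalization below possible; it persists because every row of the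
  -- Jacobian has an edge.
  have hlt : ∀ k i, x k i < r i := by
    intro k
    induction k with
    | zero => exact hB.q_pos
    | succ k ih =>
      intro i
      obtain ⟨j, hj⟩ := hB.exists_edge hE₀ i
      have h1 : 0 < jacobian P ((1 / 2 : ℝ) • (r + x k)) i j :=
        hB.β_pos.trans_le (hB.edge_le (half_smul_le_mid (hx k).1) hj)
      have h2 := Finset.single_le_sum (f := fun j =>
        jacobian P ((1 / 2 : ℝ) • (r + x k)) i j * (r j - x k j))
        (fun j _ => hterm k i j) (Finset.mem_univ j)
      rw [← hdiff] at h2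
      have h3 := mul_pos h1 (sub_pos.2 (ih j))
      linarith
  have hn : ∀ k, 0 < ‖r - x k‖ := fun k => norm_pos_iff.2 fun h => by
    have h1 : r i₀ - x k i₀ = 0 := congrFun h i₀
    have h2 := hlt k i₀
    linarith
  set w : ℕ → ι → ℝ := fun k => ‖r - x k‖⁻¹ • (r - x k) with hw
  -- B(x_k)(r - x_k) ≤ r - x_(k+1) ≤ r - x_k. This survives normalization and, along a convergent
  -- subsequence on the unit sphere, the limit x_k → r.
  have hwle : ∀ k i, ∑ j, jacobian P (x k) i j * w k j ≤ w k i := by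
    intro k i
    have h1 : ∑ j, jacobian P (x k) i j * (r j - x k j) ≤ r i - x k i := by
      calc _ ≤ ∑ j, jacobian P ((1 / 2 : ℝ) • (r + x k)) i j * (r j - x k j) :=
            Finset.sum_le_sum fun j _ => mul_le_mul_of_nonneg_right
              (jacobian_mono hB.mps (hx k).1 (le_mid (hxr k)) i j) (sub_nonneg.2 (hxr k j))
        _ = r i - x (k + 1) i := (hdiff k i).symm
        _ ≤ _ := sub_le_sub_left ((hx k).2 i) _
    have h2 := mul_le_mul_of_nonneg_left h1 (inv_nonneg.2 (hn k).le)
    rw [Finset.mul_sum] at h2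
    refine le_trans (le_of_eq (Finset.sum_congr rfl fun j _ => ?_)) h2
    simp only [hw, Pi.smul_apply, Pi.sub_apply, smul_eq_mul]
    ring
  have hsph : ∀ k, w k ∈ Metric.sphere (0 : ι → ℝ) 1 := fun k => by
    rw [mem_sphere_zero_iff_norm, hw, norm_smul, norm_inv, norm_norm,
      inv_mul_cancel₀ (hn k).ne']
  obtain ⟨v, hv, φ, hφ, hlimv⟩ := (isCompact_sphere (0 : ι → ℝ) 1).tendsto_subseq hsph
  rw [mem_sphere_zero_iff_norm] at hv
  have hv0 : 0 ≤ v := ge_of_tendsto' hlimv fun k =>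
    smul_nonneg (inv_nonneg.2 (norm_nonneg _)) (sub_nonneg.2 (hxr (φ k)))
  have hv1 : ∀ i, v i ≤ 1 := fun i => by
    have := norm_le_pi_norm v i
    rw [hv] at this
    exact (Real.le_norm_self _).trans this
  obtain ⟨m, hm⟩ : ∃ m, v m = 1 := by
    by_contra! h
    have : ‖v‖ < 1 := (pi_norm_lt_iff one_pos).2 fun i => by
      rw [Real.norm_of_nonneg (hv0 i)]
      exact lt_of_le_of_ne (hv1 i) (h i)
    exact this.ne hv
  have hvle : jacobian P r *ᵥ v ≤ v := by
    intro i
    have hl1 : Tendsto (fun k => ∑ j, jacobian P (x (φ k)) i j * w (φ k) j) atTop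
        (𝓝 (∑ j, jacobian P r i j * v j)) := by
      refine tendsto_finsetSum _ fun j _ => Tendsto.mul ?_ ?_
      · exact (((continuous_jacobian_apply P i j).tendsto r).comp hlim).comp hφ.tendsto_atTop
      · exact (tendsto_pi_nhds.1 hlimv) j
    exact le_of_tendsto_of_tendsto' hl1 ((tendsto_pi_nhds.1 hlimv) i) fun k => hwle (φ k) i
  refine ⟨v, hv1, fun i => ?_, hvle⟩
  have := pow_card_mul_le_of_mulVec_le (M := jacobian P r) hB.irred hB.β_pos.le hB.β_le
    (jacobian_nonneg hB.mps hr0) (fun a b hab => hB.edge_le hB.half_le hab) hv0 hvle i m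
  rwa [hm, mul_one] at this

theorem le_jacobian_sub (hB : IsPerturbedBlock P P' q E β U τ) {i j k : ι}
    (hH : hess P i j k ≠ 0) {x y : ι → ℝ} (hxy : x ≤ y) :
    β * (y k - x k) ≤ jacobian P y i j - jacobian P x i j := by
  rw [jacobian_sub hB.quad]
  calc β * (y k - x k) ≤ hess P i j k * (y k - x k) :=
        mul_le_mul_of_nonneg_right (hB.hess_ge i j k hH) (sub_nonneg.2 (hxy k))
    _ ≤ _ := Finset.single_le_sum (f := fun k => hess P i j k * (y k - x k))
        (fun k _ => mul_nonneg (hess_nonneg hB.mps i j k) (sub_nonneg.2 (hxy k)))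
        (Finset.mem_univ k)

theorem jacobian_sub_eq (hB : IsPerturbedBlock P P' q E β U τ) (x y : ι → ℝ) (i j : ι) :
    jacobian P' y i j - jacobian P' x i j = jacobian P y i j - jacobian P x i j := by
  rw [jacobian_sub hB.quad, jacobian_sub hB.quad']
  simp only [hB.hess_eq]

end IsPerturbedBlock

end MPS

/-! ### Newton's method on a perturbed irreducible block -/

namespace MPS

open Matrix Filter Topology

variable {ι : Type*} [Fintype ι]

theorem mulVec_jacobian_mid {P : ι → MvPolynomial ι ℝ} (hP2 : IsQuadratic P) (a b : ι → ℝ) :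
    jacobian P ((1 / 2 : ℝ) • (a + b)) *ᵥ (a - b) = evalAt P a - evalAt P b :=
  funext fun i => (evalAt_sub hP2 a b i).symm

/-- Removes the inverse from the Newton step, so that Newton iterates can be compared with other
vectors by the minimum principle. -/
theorem newton_sub_mulVec [DecidableEq ι] {P : ι → MvPolynomial ι ℝ} {x : ι → ℝ}
    (hx : NewtonDefined P x) :
    newton P x - jacobian P x *ᵥ newton P x = evalAt P x - jacobian P x *ᵥ x := by
  have h1 : (1 - jacobian P x) *ᵥ newton P x = (1 - jacobian P x) *ᵥ x + (evalAt P x - x) := by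
    rw [newton, mulVec_add, mulVec_mulVec, mul_nonsing_inv _ hx, one_mulVec]
  rw [sub_mulVec, one_mulVec, sub_mulVec, one_mulVec] at h1
  rw [h1]
  abel

theorem mulVec_mono {M M' : Matrix ι ι ℝ} (h : ∀ i j, M i j ≤ M' i j) {v : ι → ℝ} (hv : 0 ≤ v) :
    M *ᵥ v ≤ M' *ᵥ v :=
  fun i => Finset.sum_le_sum fun j _ => mul_le_mul_of_nonneg_right (h i j) (hv j)

namespace IsPerturbedBlock

variable {P P' : ι → MvPolynomial ι ℝ} {q : ι → ℝ} {E : ι → ι → Prop} {β U τ : ℝ}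

section Nonlinear

variable {i₀ j₀ k₀ : ι}

/-- The comparison matrix is B(q) with its supersolution v. A strict gap at k₀ makes entry (i₀, j₀)
strictly smaller than in B(q), since the Hessian entry is non-zero. -/
theorem minPrinciple_of_le (hB : IsPerturbedBlock P P' q E β U τ) (hH : hess P i₀ j₀ k₀ ≠ 0)
    {x : ι → ℝ} (hxq : x ≤ q) (hlt : x k₀ < q k₀) {M : Matrix ι ι ℝ}
    (hM : ∀ i j, 0 ≤ M i j) (hMx : ∀ i j, M i j ≤ jacobian P x i j) (hx : 0 ≤ x) :
    MinPrinciple M := by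
  obtain ⟨v, -, hv, hv'⟩ := hB.exists_vector (hB.edge_of_hess _ _ _ hH)
  refine MinPrinciple.of_le hB.irred hM
    (fun i j => (hMx i j).trans (jacobian_mono hB.mps hx hxq i j))
    (fun i j h => hB.β_pos.trans_le (hB.edge_le hB.half_le h))
    (fun i => (pow_pos hB.β_pos _).trans_le (hv i)) hv' (Or.inl fun h => ?_)
  have h1 := hB.le_jacobian_sub hH hxq
  have h2 := mul_pos hB.β_pos (sub_pos.2 hlt)
  have h3 := hMx i₀ j₀
  rw [h] at h3
  linarith

/-- Perturbation bound for a nonlinear irreducible block. -/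
theorem sq_sub_le (hB : IsPerturbedBlock P P' q E β U τ) (hH : hess P i₀ j₀ k₀ ≠ 0)
    {r : ι → ℝ} (hr0 : 0 ≤ r) (hrq : r ≤ q) (hr : evalAt P' r = r) (i : ι) :
    (q i - r i) ^ 2 ≤ 2 * Fintype.card ι * τ / β ^ (3 * Fintype.card ι + 1) := by
  classical
  have : Nonempty ι := ⟨i⟩
  have hβ := hB.β_pos
  have hτ := hB.τ_nonneg
  set n := Fintype.card ι
  set w := q - r with hw
  have hw0 : 0 ≤ w := sub_nonneg.2 hrq
  obtain ⟨m, -, hm⟩ := Finset.exists_max_image Finset.univ w ⟨i, by simp⟩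
  suffices h : w m ^ 2 ≤ 2 * n * τ / β ^ (3 * n + 1) from
    (pow_le_pow_left₀ (hw0 i) (hm i (by simp)) 2).trans h
  rcases (hw0 m).eq_or_lt with h0 | hpos
  · have h0' : w m = 0 := h0.symm
    rw [h0', zero_pow two_ne_zero]
    positivity
  replace hpos : 0 < w m := hpos
  set M := jacobian P ((1 / 2 : ℝ) • (q + r))
  have hmid : 0 ≤ (1 / 2 : ℝ) • (q + r) := smul_nonneg (by norm_num) (add_nonneg hB.q_nonneg hr0)
  have hM : ∀ i j, 0 ≤ M i j := jacobian_nonneg hB.mps hmid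
  have hMw : ∀ j, w j - (M *ᵥ w) j = evalAt P r j - evalAt P' r j := fun j => by
    have h1 := congrFun (mulVec_jacobian_mid hB.quad q r) j
    have h2 := congrFun hB.lfp.1.2 j
    have h3 := congrFun hr j
    rw [Pi.sub_apply] at h1
    rw [hw, Pi.sub_apply]
    linarith
  have hMe : ∀ i j, E i j → β ≤ M i j := fun i j h => hB.edge_le (half_smul_le_mid hr0) h
  have hwl : ∀ j, β ^ n * w m ≤ w j := fun j =>
    pow_card_mul_le_of_mulVec_le hB.irred hβ.le hB.β_le hM hMe hw0
      (fun j => by have := hMw j; have := hB.eval_le r hr0 hrq j; linarith) j m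
  have hk : 0 < w k₀ := (mul_pos (pow_pos hβ _) hpos).trans_le (hwl k₀)
  have hmidk : q k₀ - ((1 / 2 : ℝ) • (q + r)) k₀ = w k₀ / 2 := by
    simp only [hw, Pi.smul_apply, Pi.add_apply, Pi.sub_apply, smul_eq_mul]
    ring
  have hmin : MinPrinciple M := hB.minPrinciple_of_le hH (mid_le hrq)
    (by linarith) hM (fun _ _ => le_rfl) hmid
  obtain ⟨v, hv1, hv, hv'⟩ := hB.exists_vector (hB.edge_of_hess _ _ _ hH)
  have hv0 : 0 ≤ v := fun i => (pow_pos hβ _).le.trans (hv i)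
  have hMq : ∀ i j, M i j ≤ jacobian P q i j := fun i j =>
    jacobian_mono hB.mps hmid (mid_le hrq) i j
  -- One factor β comes from the Hessian entry, β^n from w k₀ ≥ β^n w m, β^n from v j₀, and 1/2 from
  -- the midpoint.
  have hstrict : β ^ (2 * n + 1) * w m / 2 ≤ v i₀ - (M *ᵥ v) i₀ := by
    have h1 : (jacobian P q i₀ j₀ - M i₀ j₀) * v j₀
        ≤ ∑ j, (jacobian P q i₀ j - M i₀ j) * v j :=
      Finset.single_le_sum (f := fun j => (jacobian P q i₀ j - M i₀ j) * v j)
        (fun j _ => mul_nonneg (sub_nonneg.2 (hMq i₀ j)) (hv0 j)) (Finset.mem_univ j₀)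
    have h2 : ∑ j, (jacobian P q i₀ j - M i₀ j) * v j
        = (jacobian P q *ᵥ v) i₀ - (M *ᵥ v) i₀ := by
      simp only [mulVec, dotProduct, sub_mul, Finset.sum_sub_distrib]
    have h3 := hB.le_jacobian_sub hH (mid_le hrq)
    rw [hmidk] at h3
    have h4 : β ^ (2 * n + 1) * w m / 2 ≤ (jacobian P q i₀ j₀ - M i₀ j₀) * v j₀ := by
      calc β ^ (2 * n + 1) * w m / 2 = (β * (β ^ n * w m / 2)) * β ^ n := by ring
        _ ≤ _ := by
          refine mul_le_mul (le_trans ?_ h3) (hv j₀) (by positivity)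
            (sub_nonneg.2 (hMq _ _))
          have := hwl k₀
          gcongr
    have h5 := hv' i₀
    linarith
  -- The strictness is itself proportional to w m, so the resolvent bound has w m in its
  -- denominator; clearing it yields the square.
  have key := hmin.apply_le hB.irred hβ hB.β_le hM hMe (p := v) (i := i₀)
    (s := β ^ (2 * n + 1) * w m / 2) (U := 1) (by positivity)
    ((mulVec_mono hMq hv0).trans hv') hstrict hv1 (w := w) hτ
    (fun j => by rw [hMw]; exact hB.eval_ge r hr0 hrq j) m
  have e : (n : ℝ) * (1 / (β ^ (2 * n + 1) * w m / 2) / β ^ n * τ)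
      = 2 * n * τ / β ^ (3 * n + 1) / w m := by
    rw [show 3 * n + 1 = (2 * n + 1) + n by ring, pow_add β (2 * n + 1) n]
    field_simp
  rw [e, le_div_iff₀ hpos] at key
  rwa [sq]

variable [DecidableEq ι]

omit [DecidableEq ι] in
theorem minPrinciple_jacobian (hB : IsPerturbedBlock P P' q E β U τ)
    (hH : hess P i₀ j₀ k₀ ≠ 0) {x : ι → ℝ} (hx0 : 0 ≤ x) (hxq : ∀ i, x i < q i) :
    MinPrinciple (jacobian P' x) :=
  hB.minPrinciple_of_le hH (fun i => (hxq i).le) (hxq k₀) (jacobian_nonneg hB.mps' hx0)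
    (hB.jac_le x hx0) hx0

theorem newtonDefined (hB : IsPerturbedBlock P P' q E β U τ)
    (hH : hess P i₀ j₀ k₀ ≠ 0) {x : ι → ℝ} (hx0 : 0 ≤ x) (hxq : ∀ i, x i < q i) :
    NewtonDefined P' x :=
  (hB.minPrinciple_jacobian hH hx0 hxq).isUnit_det

-- The Taylor remainder depends only on the Hessian, which the perturbation leaves alone; hence the
-- unperturbed Jacobian may appear on the right.
omit [DecidableEq ι] in
theorem newton_error_eq (hB : IsPerturbedBlock P P' q E β U τ) {x r : ι → ℝ} (i : ι) :
    evalAt P' r i - evalAt P' x i - (jacobian P' x *ᵥ (r - x)) i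
      = ∑ j, 1 / 2 * (jacobian P r i j - jacobian P x i j) * (r j - x j) := by
  rw [evalAt_sub hB.quad', mulVec, dotProduct, ← Finset.sum_sub_distrib]
  refine Finset.sum_congr rfl fun j _ => ?_
  have h1 := hB.jacobian_sub_eq x ((1 / 2 : ℝ) • (r + x)) i j
  have h2 : jacobian P ((1 / 2 : ℝ) • (r + x)) i j - jacobian P x i j
      = 1 / 2 * (jacobian P r i j - jacobian P x i j) := by
    rw [jacobian_sub hB.quad, jacobian_sub hB.quad, Finset.mul_sum]
    refine Finset.sum_congr rfl fun k _ => ?_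
    simp only [Pi.smul_apply, Pi.add_apply, smul_eq_mul]
    ring
  rw [Pi.sub_apply, ← h2, ← h1]
  ring

theorem newton_le (hB : IsPerturbedBlock P P' q E β U τ)
    (hH : hess P i₀ j₀ k₀ ≠ 0) {x r : ι → ℝ} (hx0 : 0 ≤ x) (hxq : ∀ i, x i < q i)
    (hxr : x ≤ r) (hr : evalAt P' r = r) : newton P' x ≤ r := by
  refine (hB.minPrinciple_jacobian hH hx0 hxq).le fun i => ?_
  have h1 := congrFun (newton_sub_mulVec (hB.newtonDefined hH hx0 hxq)) i
  have h2 := hB.newton_error_eq (x := x) (r := r) i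
  rw [hr, mulVec_sub] at h2
  have h3 : 0 ≤ ∑ j, 1 / 2 * (jacobian P r i j - jacobian P x i j) * (r j - x j) :=
    Finset.sum_nonneg fun j _ => mul_nonneg (mul_nonneg (by norm_num)
      (sub_nonneg.2 (jacobian_mono hB.mps hx0 hxr i j))) (sub_nonneg.2 (hxr j))
  simp only [Pi.sub_apply] at h1 h2
  linarith

/-- A Newton step halves the error, measured in the supersolution `v`. -/
theorem sub_newton_le (hB : IsPerturbedBlock P P' q E β U τ)
    (hH : hess P i₀ j₀ k₀ ≠ 0) {x r v : ι → ℝ} (hx0 : 0 ≤ x) (hxq : ∀ i, x i < q i)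
    (hxr : x ≤ r) (hrq : r ≤ q) (hr : evalAt P' r = r) (hv0 : 0 ≤ v)
    (hv : jacobian P q *ᵥ v ≤ v) {l : ℝ} (hl : 0 ≤ l) (hle : ∀ i, r i - x i ≤ l * v i) (i : ι) :
    r i - newton P' x i ≤ l / 2 * v i := by
  have key : r - newton P' x ≤ (l / 2) • v := by
    refine (hB.minPrinciple_jacobian hH hx0 hxq).le fun i => ?_
    have h1 := congrFun (newton_sub_mulVec (hB.newtonDefined hH hx0 hxq)) i
    have h2 := hB.newton_error_eq (x := x) (r := r) i
    rw [hr, mulVec_sub] at h2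
    have h3 : ∑ j, 1 / 2 * (jacobian P r i j - jacobian P x i j) * (r j - x j)
        ≤ ∑ j, 1 / 2 * (jacobian P q i j - jacobian P x i j) * (l * v j) := by
      refine Finset.sum_le_sum fun j _ => ?_
      have a1 := jacobian_mono hB.mps hx0 hxr i j
      have a2 := jacobian_mono hB.mps (hx0.trans hxr) hrq i j
      exact mul_le_mul (by linarith) (hle j) (sub_nonneg.2 (hxr j)) (by linarith)
    have h4 : ∑ j, 1 / 2 * (jacobian P q i j - jacobian P x i j) * (l * v j)
        = l / 2 * ((jacobian P q *ᵥ v) i - (jacobian P x *ᵥ v) i) := by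
      simp only [mulVec, dotProduct]
      rw [← Finset.sum_sub_distrib, Finset.mul_sum]
      exact Finset.sum_congr rfl fun j _ => by ring
    have h5 : l / 2 * ((jacobian P q *ᵥ v) i - (jacobian P x *ᵥ v) i)
        ≤ l / 2 * (v i - (jacobian P' x *ᵥ v) i) := by
      have := hv i
      have := mulVec_mono (hB.jac_le x hx0) hv0 i
      exact mul_le_mul_of_nonneg_left (by linarith) (by positivity)
    rw [mulVec_sub, mulVec_smul]
    simp only [Pi.sub_apply, Pi.smul_apply, smul_eq_mul] at h1 h2 ⊢
    linarith
  exact key i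

/-- Keeps the iterates strictly below q, as non-singularity at the next step requires. Contact with
q in one coordinate would spread along edges to i₀, where the Hessian entry excludes it. -/
theorem newton_lt (hB : IsPerturbedBlock P P' q E β U τ)
    (hH : hess P i₀ j₀ k₀ ≠ 0) {x : ι → ℝ} (hx0 : 0 ≤ x) (hxq : ∀ i, x i < q i)
    (hle : newton P' x ≤ q) (i : ι) : newton P' x i < q i := by
  refine lt_of_le_of_ne (hle i) fun hi => ?_
  have hxq' : x ≤ q := fun i => (hxq i).le
  set D := newton P' x
  set M := jacobian P ((1 / 2 : ℝ) • (q + x))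
  set M' := jacobian P' x
  have hMM' : ∀ i j, M' i j ≤ M i j := fun i j =>
    (hB.jac_le x hx0 i j).trans (jacobian_mono hB.mps hx0 (le_mid hxq') i j)
  have key : ∀ k, D k = q k → (∀ j, M k j = M' k j) ∧ ∀ j, M' k j * (q j - D j) = 0 := by
    intro k hk
    have h1 := congrFun (newton_sub_mulVec (hB.newtonDefined hH hx0 hxq)) k
    have h2 := congrFun (mulVec_jacobian_mid hB.quad q x) k
    rw [hB.lfp.1.2] at h2
    have n1 : ∀ j ∈ Finset.univ, 0 ≤ (M k j - M' k j) * (q j - x j) := fun j _ =>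
      mul_nonneg (sub_nonneg.2 (hMM' k j)) (sub_nonneg.2 (hxq' j))
    have n2 : ∀ j ∈ Finset.univ, 0 ≤ M' k j * (q j - D j) := fun j _ =>
      mul_nonneg (jacobian_nonneg hB.mps' hx0 k j) (sub_nonneg.2 (hle j))
    have s1 : ∑ j, (M k j - M' k j) * (q j - x j)
        = (M *ᵥ (q - x)) k - (M' *ᵥ q) k + (M' *ᵥ x) k := by
      simp only [mulVec, dotProduct, ← Finset.sum_sub_distrib, ← Finset.sum_add_distrib]
      exact Finset.sum_congr rfl fun j _ => by rw [Pi.sub_apply]; ring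
    have s2 : ∑ j, M' k j * (q j - D j) = (M' *ᵥ q) k - (M' *ᵥ D) k := by
      simp only [mulVec, dotProduct, ← Finset.sum_sub_distrib]
      exact Finset.sum_congr rfl fun j _ => by ring
    have h3 := hB.eval_le x hx0 hxq' k
    have p1 := Finset.sum_nonneg n1
    have p2 := Finset.sum_nonneg n2
    simp only [Pi.sub_apply] at h1 h2
    have z1 : ∑ j, (M k j - M' k j) * (q j - x j) = 0 := by linarith
    have z2 : ∑ j, M' k j * (q j - D j) = 0 := by linarith
    refine ⟨fun j => ?_, fun j => (Finset.sum_eq_zero_iff_of_nonneg n2).1 z2 j (by simp)⟩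
    have := (Finset.sum_eq_zero_iff_of_nonneg n1).1 z1 j (by simp)
    exact sub_eq_zero.1 ((mul_eq_zero.1 this).resolve_right (sub_pos.2 (hxq j)).ne')
  have hall := forall_of_edge_closed hB.irred (p := fun k => D k = q k) (fun a b hab ha => by
    obtain ⟨h1, h2⟩ := key a ha
    have h3 : β ≤ M a b := hB.edge_le (half_smul_le_mid hx0) hab
    have h4 : M' a b ≠ 0 := by rw [← h1]; exact (hB.β_pos.trans_le h3).ne'
    exact (sub_eq_zero.1 ((mul_eq_zero.1 (h2 b)).resolve_left h4)).symm) hi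
  have h1 := (key i₀ (hall i₀)).1 j₀
  have h2 := hB.le_jacobian_sub hH (le_mid hxq')
  have h3 := hB.jac_le x hx0 i₀ j₀
  have h4 : 0 < β * (((1 / 2 : ℝ) • (q + x)) k₀ - x k₀) := by
    refine mul_pos hB.β_pos ?_
    have := hxq k₀
    simp only [Pi.smul_apply, Pi.add_apply, smul_eq_mul]
    linarith
  change M i₀ j₀ = jacobian P' x i₀ j₀ at h1
  change _ ≤ M i₀ j₀ - _ at h2
  linarith

theorem rnm_nonlinear (hB : IsPerturbedBlock P P' q E β U τ)
    (hH : hess P i₀ j₀ k₀ ≠ 0) (h : ℤ) (m : ℕ) :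
    NewtonDefined P' (rnm P' h m) ∧ 0 ≤ rnm P' h m ∧ ∀ i, rnm P' h m i ≤ q i ∧
      q i - rnm P' h m i ≤ √(2 * Fintype.card ι * τ / β ^ (3 * Fintype.card ι + 1))
        + (U * (2 : ℝ)⁻¹ ^ m + 2 * (2 : ℝ) ^ (-h)) / β ^ Fintype.card ι := by
  have hβ := hB.β_pos
  obtain ⟨r, hr0, hrq, hr, -, -⟩ := exists_fixedPoint_tendsto hB.mps' hB.q_nonneg
    (fun i => (hB.eval_le q hB.q_nonneg le_rfl i).trans (congrFun hB.lfp.1.2 i).le)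
  obtain ⟨v, hv1, hv, hv'⟩ := hB.exists_vector (hB.edge_of_hess _ _ _ hH)
  set n := Fintype.card ι
  have hv0 : 0 ≤ v := fun i => (pow_pos hβ _).le.trans (hv i)
  have hU : 0 ≤ U := (hB.q_nonneg i₀).trans (hB.q_le i₀)
  -- Each step halves the multiple of v and adds at most 2^(-h)/β^n to it. The term 2·2^(-h) is the
  -- fixed point of t ↦ t/2 + 2^(-h), and U/β^n covers the start.
  have key : ∀ m, 0 ≤ rnm P' h m ∧ (∀ i, rnm P' h m i < q i) ∧ rnm P' h m ≤ r ∧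
      ∀ i, r i - rnm P' h m i
        ≤ (U * (2 : ℝ)⁻¹ ^ m + 2 * (2 : ℝ) ^ (-h)) / β ^ n * v i := by
    intro m
    induction m with
    | zero =>
      refine ⟨le_rfl, hB.q_pos, hr0, fun i => ?_⟩
      have h1 : r i ≤ U := (hrq i).trans (hB.q_le i)
      have h2 : U ≤ U / β ^ n * v i := by
        rw [div_mul_eq_mul_div, le_div_iff₀ (pow_pos hβ _)]
        exact mul_le_mul_of_nonneg_left (hv i) hU
      have h3 : 0 ≤ 2 * (2 : ℝ) ^ (-h) / β ^ n * v i := mul_nonneg (by positivity) (hv0 i)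
      simp only [rnm, Pi.zero_apply, sub_zero, pow_zero, mul_one, add_div, add_mul]
      linarith
    | succ m ih =>
      obtain ⟨i1, i2, i3, i4⟩ := ih
      have h1 := hB.newton_le hH i1 i2 i3 hr
      have h2 := hB.newton_lt hH i1 i2 (h1.trans hrq)
      have h3 := hB.sub_newton_le hH i1 i2 i3 hrq hr hv0 hv' (by positivity) i4
      refine ⟨fun i => roundDown_nonneg _ _, fun i => ?_, fun i => ?_, fun i => ?_⟩
      · exact (roundDown_le h _).trans_lt (max_lt (h2 i) (hB.q_pos i))
      · exact (roundDown_le h _).trans (max_le (h1 i) (hr0 i))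
      · have h4 := sub_le_roundDown h (newton P' (rnm P' h m) i)
        have h5 : (2 : ℝ) ^ (-h) ≤ (2 : ℝ) ^ (-h) / β ^ n * v i := by
          rw [div_mul_eq_mul_div, le_div_iff₀ (pow_pos hβ _)]
          exact mul_le_mul_of_nonneg_left (hv i) (by positivity)
        have h6 : (U * (2 : ℝ)⁻¹ ^ (m + 1) + 2 * (2 : ℝ) ^ (-h)) / β ^ n * v i
            = (U * (2 : ℝ)⁻¹ ^ m + 2 * (2 : ℝ) ^ (-h)) / β ^ n / 2 * v i
              + (2 : ℝ) ^ (-h) / β ^ n * v i := by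
          rw [pow_succ]; ring
        rw [h6]
        have h7 := h3 i
        change r i - roundDown h (newton P' (rnm P' h m) i) ≤ _
        linarith
  obtain ⟨k1, k2, k3, k4⟩ := key m
  refine ⟨hB.newtonDefined hH k1 k2, k1, fun i => ⟨(k2 i).le, ?_⟩⟩
  have h1 : q i - r i ≤ √(2 * n * τ / β ^ (3 * n + 1)) :=
    Real.le_sqrt_of_sq_le (hB.sq_sub_le hH hr0 hrq hr i)
  have h2 := mul_le_mul_of_nonneg_left (hv1 i)
    (by positivity : 0 ≤ (U * (2 : ℝ)⁻¹ ^ m + 2 * (2 : ℝ) ^ (-h)) / β ^ n)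
  have h3 := k4 i
  linarith

end Nonlinear

section Linear

variable [DecidableEq ι]

/-- Both Jacobians are constant, so one Newton step is exact. The supersolution is now q itself: q -
B q is the constant term, which is non-zero somewhere because the least fixed point is not 0. -/
theorem rnm_linear (hB : IsPerturbedBlock P P' q E β U τ) [Nonempty ι]
    (hH : ∀ i j k, hess P i j k = 0) (h : ℤ) :
    NewtonDefined P' (rnm P' h 0) ∧ 0 ≤ rnm P' h 1 ∧ ∀ i, rnm P' h 1 i ≤ q i ∧
      q i - rnm P' h 1 i
        ≤ Fintype.card ι * (U / β ^ 2 / β ^ Fintype.card ι * τ) + (2 : ℝ) ^ (-h) := by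
  have hβ := hB.β_pos
  have hq := hB.q_nonneg
  have hconst : ∀ x y, jacobian P x = jacobian P y := fun x y => Matrix.ext fun i j => by
    have := jacobian_sub hB.quad x y i j
    simp only [hH, zero_mul, Finset.sum_const_zero] at this
    linarith
  have hconst' : ∀ x y, jacobian P' x = jacobian P' y := fun x y => Matrix.ext fun i j => by
    have := jacobian_sub hB.quad' x y i j
    simp only [hB.hess_eq, hH, zero_mul, Finset.sum_const_zero] at this
    linarith
  have hAq : ∀ i, (jacobian P q *ᵥ q) i = q i - evalAt P 0 i := fun i => by
    have := congrFun (mulVec_jacobian_mid hB.quad q 0) i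
    rw [sub_zero, hconst _ q, hB.lfp.1.2] at this
    exact this
  have hAq' : ∀ i, (jacobian P' 0 *ᵥ q) i = evalAt P' q i - evalAt P' 0 i := fun i => by
    have := congrFun (mulVec_jacobian_mid hB.quad' q 0) i
    rwa [sub_zero, hconst' _ 0] at this
  obtain ⟨i₀, hi₀⟩ : ∃ i, evalAt P 0 i ≠ 0 := by
    by_contra! hc
    obtain ⟨i⟩ := ‹Nonempty ι›
    exact absurd (hB.lfp.2 ⟨le_rfl, funext hc⟩ i) (not_le.2 (hB.q_pos i))
  have hA0 : ∀ i j, 0 ≤ jacobian P q i j := jacobian_nonneg hB.mps hq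
  have hAE : ∀ i j, E i j → β ≤ jacobian P q i j := fun i j hij => hB.edge_le hB.half_le hij
  have hle : jacobian P q *ᵥ q ≤ q := fun i => by
    have h0 := evalAt_nonneg hB.mps (le_refl (0 : ι → ℝ)) i
    rw [hAq]
    simpa using h0
  have hne : jacobian P q *ᵥ q ≠ q := fun hc => hi₀ <| by
    have := hAq i₀
    rw [hc] at this
    linarith
  have hA'A : ∀ i j, jacobian P' 0 i j ≤ jacobian P q i j := fun i j => by
    rw [hconst q 0]; exact hB.jac_le 0 le_rfl i j
  have hminA : MinPrinciple (jacobian P q) := MinPrinciple.of_le hB.irred hA0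
    (fun _ _ => le_rfl) (fun i j hij => hβ.trans_le (hAE i j hij)) hB.q_pos hle (Or.inr hne)
  have hminA' : MinPrinciple (jacobian P' 0) := MinPrinciple.of_le hB.irred
    (jacobian_nonneg hB.mps' le_rfl) hA'A (fun i j hij => hβ.trans_le (hAE i j hij))
    hB.q_pos hle (Or.inr hne)
  have hdef : NewtonDefined P' (0 : ι → ℝ) := hminA'.isUnit_det
  set D := newton P' 0 with hD
  have hDeq : ∀ i, D i - (jacobian P' 0 *ᵥ D) i = evalAt P' 0 i := fun i => by
    have := congrFun (newton_sub_mulVec hdef) i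
    simpa using this
  have hDq : D ≤ q := hminA'.le fun i => by
    have h1 := hB.eval_le q hq le_rfl i
    have h2 := congrFun hB.lfp.1.2 i
    rw [hDeq, hAq']
    linarith
  have herr : ∀ i, (q - D) i - (jacobian P q *ᵥ (q - D)) i ≤ τ := fun i => by
    have h1 := mulVec_mono hA'A (sub_nonneg.2 hDq) i
    have h2 := hB.eval_ge q hq le_rfl i
    have h3 := congrFun hB.lfp.1.2 i
    have h4 := hDeq i
    have h5 := hAq' i
    rw [mulVec_sub] at h1
    simp only [Pi.sub_apply] at h1 ⊢
    linarith
  have hbound := hminA.apply_le hB.irred hβ hB.β_le hA0 hAE (p := q) (i := i₀) (s := β ^ 2)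
    (by positivity) hle (by rw [hAq]; have := hB.const_ge i₀ hi₀; linarith) hB.q_le hB.τ_nonneg
    herr
  refine ⟨hdef, fun i => roundDown_nonneg _ _, fun i => ⟨?_, ?_⟩⟩
  · exact (roundDown_le h _).trans (max_le (hDq i) (hq i))
  · have h1 := sub_le_roundDown h (D i)
    have h2 := hbound i
    rw [Pi.sub_apply] at h2
    change q i - roundDown h (D i) ≤ _
    linarith

end Linear

end IsPerturbedBlock

end MPS

/-! ### Substitution, subsystems and components -/

namespace MPS

section Polynomials

variable {σ τ : Type*}

theorem totalDegree_le_one_of_pderiv_pderiv {p : MvPolynomial σ ℝ} (hp : p.totalDegree ≤ 2)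
    (h : ∀ j k, eval 0 (pderiv k (pderiv j p)) = 0) : p.totalDegree ≤ 1 := by
  have split : ∀ m : σ →₀ ℕ, m ≠ 0 →
      ∃ j m', m = m' + Finsupp.single j 1 ∧ Finsupp.degree m = Finsupp.degree m' + 1 := by
    intro m hm
    obtain ⟨j, hj⟩ := Finsupp.ne_iff.1 hm
    have hle : Finsupp.single j 1 ≤ m := by
      rw [Finsupp.single_le_iff]
      simp only [Finsupp.coe_zero, Pi.zero_apply] at hj
      omega
    refine ⟨j, m - Finsupp.single j 1, (tsub_add_cancel_of_le hle).symm, ?_⟩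
    conv_lhs => rw [← tsub_add_cancel_of_le hle, map_add, Finsupp.degree_single]
  refine Finset.sup_le fun m hm => ?_
  change Finsupp.degree m ≤ 1
  by_contra! hlt
  have h2 : Finsupp.degree m ≤ 2 := (le_totalDegree hm).trans hp
  obtain ⟨j, m', rfl, h3⟩ := split m fun h0 => by simp [h0] at hlt
  obtain ⟨k, m'', rfl, h4⟩ := split m' fun h0 => by
    rw [h3, h0, map_zero] at hlt; omega
  have h5 : m'' = 0 := by
    rw [← Finsupp.degree_eq_zero_iff]; omega
  subst h5
  have h6 := h j k
  rw [eval_zero, constantCoeff_eq, coeff_pderiv, coeff_pderiv] at h6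
  refine mem_support_iff.1 hm (((mul_eq_zero.1 h6).resolve_right ?_ |> mul_eq_zero.1).resolve_right
    ?_) <;> positivity

theorem pderiv_pderiv_of_totalDegree_le_one {p : MvPolynomial σ ℝ} (hp : p.totalDegree ≤ 1)
    (j k : σ) : eval 0 (pderiv k (pderiv j p)) = 0 := by
  rw [eval_zero, constantCoeff_eq, coeff_pderiv, coeff_pderiv]
  have : coeff (0 + Finsupp.single k 1 + Finsupp.single j 1) p = 0 := by
    refine coeff_eq_zero_of_totalDegree_lt (hp.trans_lt ?_)
    change 1 < Finsupp.degree (0 + Finsupp.single k 1 + Finsupp.single j 1)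
    simp
  rw [this, zero_mul, zero_mul]

theorem eval_pderiv_pderiv {p : MvPolynomial σ ℝ} (hp : p.totalDegree ≤ 2) (j k : σ)
    (z : σ → ℝ) : eval z (pderiv k (pderiv j p)) = eval 0 (pderiv k (pderiv j p)) := by
  classical
  refine quadratic_induction (M := fun p => eval z (pderiv k (pderiv j p))
    = eval 0 (pderiv k (pderiv j p))) ?_ ?_ ?_ ?_ p hp
  · intro c; simp
  · intro c l
    simp only [pderiv_C_mul, pderiv_X, Pi.single_apply]
    split_ifs <;> simp
  · intro c l m
    simp only [pderiv_mul, pderiv_X, Pi.single_apply]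
    split_ifs <;> simp [pderiv_X, Pi.single_apply] <;> split_ifs <;> simp
  · intro p r hp hr
    simp only [map_add, hp, hr]

theorem coeff_mul_nonneg {p r : MvPolynomial σ ℝ} (hp : ∀ m, 0 ≤ p.coeff m)
    (hr : ∀ m, 0 ≤ r.coeff m) (m : σ →₀ ℕ) : 0 ≤ (p * r).coeff m := by
  classical
  rw [coeff_mul]
  exact Finset.sum_nonneg fun x _ => mul_nonneg (hp _) (hr _)

theorem coeff_C_nonneg {c : ℝ} (hc : 0 ≤ c) (m : σ →₀ ℕ) :
    0 ≤ (C c : MvPolynomial σ ℝ).coeff m := by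
  classical
  rw [coeff_C]; split_ifs <;> simp [hc]

theorem coeff_bind₁_nonneg {p : MvPolynomial σ ℝ} (hp : ∀ m, 0 ≤ p.coeff m)
    {θ : σ → MvPolynomial τ ℝ} (hθ : ∀ j m, 0 ≤ (θ j).coeff m) (m : τ →₀ ℕ) :
    0 ≤ (bind₁ θ p).coeff m := by
  rw [p.as_sum, map_sum, coeff_sum]
  refine Finset.sum_nonneg fun d _ => ?_
  rw [bind₁_monomial]
  refine coeff_mul_nonneg (coeff_C_nonneg (hp d)) ?_ m
  refine Finset.prod_induction _ (fun r : MvPolynomial τ ℝ => ∀ m, 0 ≤ r.coeff m)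
    (fun _ _ => coeff_mul_nonneg) (coeff_C_nonneg zero_le_one) fun j _ => ?_
  generalize d j = e
  induction e with
  | zero => rw [pow_zero]; exact coeff_C_nonneg zero_le_one
  | succ e ih => rw [pow_succ]; exact coeff_mul_nonneg ih (hθ j)

theorem totalDegree_bind₁_le_two {p : MvPolynomial σ ℝ} (hp : p.totalDegree ≤ 2)
    {θ : σ → MvPolynomial τ ℝ} (hθ : ∀ j, (θ j).totalDegree ≤ 1) :
    (bind₁ θ p).totalDegree ≤ 2 := by
  refine quadratic_induction (M := fun p => (bind₁ θ p).totalDegree ≤ 2) ?_ ?_ ?_ ?_ p hp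
  · intro c; simp
  · intro c j
    rw [map_mul, bind₁_C_right, bind₁_X_right]
    refine (totalDegree_mul _ _).trans ?_
    rw [totalDegree_C]
    have := hθ j
    omega
  · intro c j k
    rw [map_mul, map_mul, bind₁_C_right, bind₁_X_right, bind₁_X_right]
    refine (totalDegree_mul _ _).trans ?_
    have h1 := totalDegree_mul (θ j) (θ k)
    rw [totalDegree_C]
    have := hθ j
    have := hθ k
    omega
  · intro p r hp hr
    rw [map_add]
    exact (totalDegree_add _ _).trans (max_le hp hr)

end Polynomials

section Subsystem

variable {σ : Type*} [DecidableEq σ] {S : Finset σ}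

/-- The vector that agrees with `x` on `S` and with `y` outside. -/
def glue (S : Finset σ) (x : S → ℝ) (y : σ → ℝ) : σ → ℝ :=
  fun j => if hj : j ∈ S then x ⟨j, hj⟩ else y j

theorem glue_coe (x : S → ℝ) (y : σ → ℝ) (i : S) : glue S x y i = x i := by
  simp [glue]

theorem glue_of_notMem (x : S → ℝ) (y : σ → ℝ) {j : σ} (hj : j ∉ S) : glue S x y j = y j := by
  simp [glue, hj]

theorem glue_restrict (y : σ → ℝ) : glue S (fun i : S => y i) y = y := by
  funext j
  simp [glue]

theorem glue_mono {x x' : S → ℝ} {y y' : σ → ℝ} (hx : x ≤ x') (hy : y ≤ y') :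
    glue S x y ≤ glue S x' y' := fun j => by
  by_cases hj : j ∈ S
  · simpa [glue, hj] using hx ⟨j, hj⟩
  · simpa [glue, hj] using hy j

theorem glue_nonneg {x : S → ℝ} {y : σ → ℝ} (hx : 0 ≤ x) (hy : 0 ≤ y) : 0 ≤ glue S x y :=
  fun j => by
    by_cases hj : j ∈ S
    · simpa [glue, hj] using hx ⟨j, hj⟩
    · simpa [glue, hj] using hy j

theorem eval_bind₁_glue (p : MvPolynomial σ ℝ) (x : S → ℝ) (y : σ → ℝ) :
    eval x (bind₁ (fun j => if hj : j ∈ S then X ⟨j, hj⟩ else C (y j)) p)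
      = eval (glue S x y) p := by
  induction p using MvPolynomial.induction_on with
  | C a => simp
  | add p r hp hr => simp only [map_add, hp, hr]
  | mul_X p j hp =>
    rw [map_mul, map_mul, hp, map_mul, bind₁_X_right, eval_X]
    congr 1
    unfold glue
    split_ifs <;> simp

theorem pderiv_bind₁_glue (p : MvPolynomial σ ℝ) (y : σ → ℝ) (k : S) :
    pderiv k (bind₁ (fun j => if hj : j ∈ S then X ⟨j, hj⟩ else C (y j)) p)
      = bind₁ (fun j => if hj : j ∈ S then (X ⟨j, hj⟩ : MvPolynomial S ℝ) else C (y j))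
          (pderiv (k : σ) p) := by
  induction p using MvPolynomial.induction_on with
  | C a => simp
  | add p r hp hr => simp only [map_add, hp, hr]
  | mul_X p j hp =>
    rw [map_mul, pderiv_mul, pderiv_mul, hp, map_add, map_mul, map_mul, bind₁_X_right]
    congr 2
    by_cases hj : j ∈ S
    · rw [dif_pos hj, pderiv_X, pderiv_X]
      by_cases hjk : j = k
      · subst hjk; simp
      · have : (⟨j, hj⟩ : S) ≠ k := fun h => hjk (by rw [← h])
        simp [hjk, this]
    · have hjk : j ≠ k := fun h => hj (h ▸ k.2)
      rw [dif_neg hj, pderiv_C, pderiv_X_of_ne hjk, map_zero]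

variable {Q : σ → MvPolynomial σ ℝ}

theorem evalAt_subsystem (x : S → ℝ) (y : σ → ℝ) (i : S) :
    evalAt (subsystem Q S y) x i = evalAt Q (glue S x y) i :=
  eval_bind₁_glue _ _ _

theorem jacobian_subsystem (x : S → ℝ) (y : σ → ℝ) (i j : S) :
    jacobian (subsystem Q S y) x i j = jacobian Q (glue S x y) i j := by
  simp only [jacobian, Matrix.of_apply, subsystem]
  rw [pderiv_bind₁_glue, eval_bind₁_glue]

theorem hess_subsystem (hQ2 : IsQuadratic Q) (y : σ → ℝ) (i j k : S) :
    hess (subsystem Q S y) i j k = hess Q i j k := by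
  simp only [hess, subsystem]
  rw [pderiv_bind₁_glue, pderiv_bind₁_glue, eval_bind₁_glue, eval_pderiv_pderiv (hQ2 i)]

theorem isMPS_subsystem (hQ : IsMPS Q) {y : σ → ℝ} (hy : 0 ≤ y) : IsMPS (subsystem Q S y) :=
  fun i m => by
    refine coeff_bind₁_nonneg (hQ i) (fun j m => ?_) m
    split_ifs with hj
    · classical
      rw [coeff_X]
      split_ifs <;> norm_num
    · exact coeff_C_nonneg (hy j) m

theorem isQuadratic_subsystem (hQ2 : IsQuadratic Q) (y : σ → ℝ) :
    IsQuadratic (subsystem Q S y) := fun i => by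
  refine totalDegree_bind₁_le_two (hQ2 i) fun j => ?_
  split_ifs
  · rw [totalDegree_X]
  · rw [totalDegree_C]; exact zero_le_one

/-- Substituting constants outside S leaves second derivatives within S unchanged, so linearity does
not depend on the values plugged in. -/
theorem isLinearSCC_iff (hQ2 : IsQuadratic Q) (q : σ → ℝ) :
    IsLinearSCC Q q S ↔ ∀ i j k : S, hess Q i j k = 0 := by
  constructor
  · intro h i j k
    rw [← hess_subsystem hQ2 q]
    exact pderiv_pderiv_of_totalDegree_le_one (h i) j k
  · intro h i
    refine totalDegree_le_one_of_pderiv_pderiv (isQuadratic_subsystem hQ2 q i) fun j k => ?_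
    have := h i j k
    rwa [← hess_subsystem hQ2 q] at this

theorem subsystem_congr {y y' : σ → ℝ}
    (h : ∀ i ∈ S, ∀ j ∈ (Q i).vars, j ∉ S → y j = y' j) :
    subsystem Q S y = subsystem Q S y' := by
  funext i
  refine eval₂Hom_congr' rfl (fun j hj _ => ?_) rfl
  by_cases hS : j ∈ S
  · rw [dif_pos hS, dif_pos hS]
  · rw [dif_neg hS, dif_neg hS, h i i.2 j hj hS]

theorem isLFP_subsystem [Fintype σ] (hQ : IsMPS Q) {q : σ → ℝ} (hq : IsLFP Q q) :
    IsLFP (subsystem Q S q) fun i : S => q i := by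
  obtain ⟨⟨hq0, hqf⟩, hmin⟩ := hq
  refine ⟨⟨fun i => hq0 i, funext fun i => ?_⟩, ?_⟩
  · rw [evalAt_subsystem, glue_restrict, hqf]
  · rintro a ⟨ha0, haf⟩
    -- Cutting a off at q and extending by q gives z with Q(z) ≤ z ≤ q. Below z lies a fixed point
    -- of the whole system, which dominates q by minimality.
    set b : S → ℝ := fun i => min (a i) (q i) with hb
    have hb0 : 0 ≤ b := fun i => le_min (ha0 i) (hq0 i)
    have hz0 : 0 ≤ glue S b q := glue_nonneg hb0 hq0
    have hzq : glue S b q ≤ q := by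
      conv_rhs => rw [← glue_restrict (S := S) q]
      exact glue_mono (fun i => min_le_right _ _) le_rfl
    have hle : evalAt Q (glue S b q) ≤ glue S b q := by
      intro i
      have h1 := evalAt_mono hQ hz0 hzq i
      rw [hqf] at h1
      by_cases hi : i ∈ S
      · have h2 : glue S b q i = b ⟨i, hi⟩ := glue_coe b q ⟨i, hi⟩
        rw [h2]
        refine le_min ?_ h1
        have h3 := evalAt_mono hQ hz0
          (glue_mono (x' := a) (fun i => min_le_left _ _) (le_refl q)) i
        have h4 := evalAt_subsystem (Q := Q) a q ⟨i, hi⟩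
        rw [haf] at h4
        exact h3.trans h4.symm.le
      · rwa [glue_of_notMem b q hi]
    obtain ⟨r, hr0, hrz, hrf, -, -⟩ := exists_fixedPoint_tendsto hQ hz0 hle
    intro i
    have h5 := (hmin ⟨hr0, hrf⟩ (i : σ)).trans (hrz i)
    rw [glue_coe] at h5
    exact h5.trans (min_le_left _ _)

end Subsystem

section Components

variable {σ : Type*} [Fintype σ] {Q : σ → MvPolynomial σ ℝ}

theorem mem_scc {i j : σ} : j ∈ scc Q i ↔ Reach Q i j ∧ Reach Q j i := by
  simp [scc]

theorem self_mem_scc (i : σ) : i ∈ scc Q i :=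
  mem_scc.2 ⟨Relation.ReflTransGen.refl, Relation.ReflTransGen.refl⟩

theorem scc_eq_of_mem {i j : σ} (h : j ∈ scc Q i) : scc Q j = scc Q i := by
  obtain ⟨h1, h2⟩ := mem_scc.1 h
  ext k
  rw [mem_scc, mem_scc]
  exact ⟨fun h => ⟨h1.trans h.1, h.2.trans h2⟩, fun h => ⟨h2.trans h.1, h.2.trans h1⟩⟩

theorem IsSCC.eq_scc {S : Finset σ} (hS : IsSCC Q S) {i : σ} (hi : i ∈ S) : S = scc Q i := by
  obtain ⟨j, rfl⟩ := hS
  exact (scc_eq_of_mem hi).symm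

theorem IsSCC.reflTransGen {S : Finset σ} (hS : IsSCC Q S) (i j : S) :
    Relation.ReflTransGen (fun a b : S => DepEdge Q a b) i j := by
  obtain ⟨i, hi⟩ := i
  obtain ⟨j, hj⟩ := j
  obtain rfl := hS.eq_scc hj
  obtain ⟨h1, h2⟩ := mem_scc.1 hi
  clear h1
  induction h2 using Relation.ReflTransGen.head_induction_on with
  | refl => exact Relation.ReflTransGen.refl
  | head hab hbj ih =>
    rename_i a b
    have hb : b ∈ scc Q j := mem_scc.2 ⟨(mem_scc.1 hi).1.tail hab, hbj⟩
    exact Relation.ReflTransGen.head (b := ⟨b, hb⟩) hab (ih hb)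

open Classical in
/-- The number of variables on which `x_i` depends. -/
noncomputable def rank (Q : σ → MvPolynomial σ ℝ) (i : σ) : ℕ :=
  (Finset.univ.filter fun j => Reach Q i j).card

theorem rank_le_of_reach {i j : σ} (h : Reach Q i j) : rank Q j ≤ rank Q i := by
  classical
  refine Finset.card_le_card fun k hk => ?_
  simp only [Finset.mem_filter, Finset.mem_univ, true_and] at hk ⊢
  exact h.trans hk

theorem rank_lt {i j : σ} (h : Reach Q i j) (h' : ¬ Reach Q j i) : rank Q j < rank Q i := by
  classical
  refine Finset.card_lt_card (Finset.ssubset_iff_of_subset (fun k hk => ?_) |>.2 ⟨i, ?_, ?_⟩)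
  · simp only [Finset.mem_filter, Finset.mem_univ, true_and] at hk ⊢
    exact h.trans hk
  · exact Finset.mem_filter.2 ⟨Finset.mem_univ i, Relation.ReflTransGen.refl⟩
  · simpa using h'

theorem rank_lt_of_mem_vars {i j k : σ} (hk : k ∈ scc Q i) (hj : j ∈ (Q k).vars)
    (hjS : j ∉ scc Q i) : rank Q j < rank Q i := by
  obtain ⟨h1, h2⟩ := mem_scc.1 hk
  have h3 : Reach Q i j := h1.tail hj
  exact rank_lt h3 fun h => hjS (mem_scc.2 ⟨h3, h⟩)

end Components

end MPS

/-! ### Error on a single component; existence and uniqueness of the output -/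

namespace MPS

section Blocks

variable {σ : Type*} [Fintype σ] [DecidableEq σ] {Q : σ → MvPolynomial σ ℝ} {q : σ → ℝ}

theorem isPerturbedBlock_subsystem (hQ : IsMPS Q) (hQ2 : IsQuadratic Q) (hq : IsLFP Q q)
    {s U : ℝ} (hs : 0 < s) (hs1 : s ≤ 1) (hsq : ∀ i, s ≤ 1 / 2 * q i) (hU : 1 ≤ U)
    (hqU : ∀ i, q i ≤ U) (hc : 0 < cMin Q) {S : Finset σ} (hS : IsSCC Q S) {y : σ → ℝ}
    (hy0 : 0 ≤ y) (hyq : y ≤ q) {δ : ℝ} (hδ : 0 ≤ δ)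
    (hyδ : ∀ i ∈ S, ∀ j ∈ (Q i).vars, j ∉ S → q j - y j ≤ δ) :
    IsPerturbedBlock (subsystem Q S q) (subsystem Q S y) (fun i : S => q i)
      (fun a b => DepEdge Q a b) (min 1 (cMin Q) * s) U (2 * U * ‖evalAt Q 1‖ * δ) := by
  have hq0 : 0 ≤ q := hq.1.1
  have hβs : min 1 (cMin Q) * s ≤ cMin Q * s :=
    mul_le_mul_of_nonneg_right (min_le_right _ _) hs.le
  have hm0 : 0 < min 1 (cMin Q) := lt_min one_pos hc
  refine ⟨isMPS_subsystem hQ hq0, isQuadratic_subsystem hQ2 q, isMPS_subsystem hQ hy0,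
    isQuadratic_subsystem hQ2 y, fun i j k => ?_, fun z hz i j => ?_, fun z hz hzq i => ?_,
    fun z hz hzq i => ?_, isLFP_subsystem hQ hq, fun i => ?_, fun i => hqU i, hS.reflTransGen,
    by positivity, mul_le_one₀ (min_le_left _ _) hs.le hs1, fun i j hij => ?_,
    fun i j k h => ?_, fun i j k h => ?_, fun i h => ?_⟩
  · rw [hess_subsystem hQ2, hess_subsystem hQ2]
  · rw [jacobian_subsystem, jacobian_subsystem]
    exact jacobian_mono hQ (glue_nonneg hz hy0) (glue_mono le_rfl hyq) i j
  · rw [evalAt_subsystem, evalAt_subsystem]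
    exact evalAt_mono hQ (glue_nonneg hz hy0) (glue_mono le_rfl hyq) i
  · rw [evalAt_subsystem, evalAt_subsystem, evalAt_sub hQ2]
    set m := (1 / 2 : ℝ) • (glue S z q + glue S z y) with hm
    have hzy : glue S z y ≤ q := by
      refine (glue_mono hzq hyq).trans_eq ?_
      exact glue_restrict q
    have hzq' : glue S z q ≤ q := by
      conv_rhs => rw [← glue_restrict (S := S) q]
      exact glue_mono hzq le_rfl
    have hm1 : 0 ≤ m :=
      smul_nonneg (by norm_num) (add_nonneg (glue_nonneg hz hq0) (glue_nonneg hz hy0))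
    have hmU : ∀ j, m j ≤ U := fun j => by
      have h1 := hzy j
      have h2 := hzq' j
      have h3 := hqU j
      simp only [hm, Pi.smul_apply, Pi.add_apply, smul_eq_mul]
      linarith
    have hterm : ∀ j, jacobian Q m i j * (glue S z q j - glue S z y j)
        ≤ jacobian Q m i j * δ := by
      intro j
      by_cases hj : j ∈ (Q i).vars
      · refine mul_le_mul_of_nonneg_left ?_ (jacobian_nonneg hQ hm1 i j)
        by_cases hjS : j ∈ S
        · simpa [glue, hjS] using hδ
        · rw [glue_of_notMem _ _ hjS, glue_of_notMem _ _ hjS]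
          exact hyδ i i.2 j hj hjS
      · rw [jacobian_eq_zero hj, zero_mul, zero_mul]
    calc _ ≤ ∑ j, jacobian Q m i j * δ := Finset.sum_le_sum fun j _ => hterm j
      _ = (∑ j, jacobian Q m i j) * δ := by rw [Finset.sum_mul]
      _ ≤ (2 * U * evalAt Q 1 i) * δ :=
        mul_le_mul_of_nonneg_right (sum_jacobian_le hQ hQ2 hU hm1 hmU i) hδ
      _ ≤ _ := by
        have := (Real.le_norm_self _).trans (norm_le_pi_norm (evalAt Q 1) i)
        gcongr
  · have := hsq i
    linarith
  · rw [jacobian_subsystem]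
    refine hβs.trans (cMin_mul_le_jacobian hQ hQ2 hij hs.le hs1 fun k => ?_)
    have := hsq k
    by_cases hk : k ∈ S
    · simpa [glue, hk] using this
    · rw [glue_of_notMem _ _ hk]
      linarith [hq0 k, show (0 : ℝ) ≤ q k from hq0 k]
  · rw [hess_subsystem hQ2] at h
    by_contra hn
    refine h ?_
    rw [hess, pderiv_eq_zero_of_notMem_vars (show (j : σ) ∉ (Q i).vars from hn), map_zero,
      map_zero]
  · rw [hess_subsystem hQ2] at h ⊢
    exact (hβs.trans (mul_le_of_le_one_right hc.le hs1)).trans (cMin_le_hess hQ h)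
  · rw [evalAt_subsystem] at h ⊢
    refine le_trans ?_ (cMin_mul_sq_le_evalAt hQ hQ2 hs.le hs1 (fun j => ?_) h)
    · rw [mul_pow]
      refine mul_le_mul_of_nonneg_right ?_ (by positivity)
      refine le_trans ?_ (min_le_right 1 (cMin Q))
      rw [sq]
      exact mul_le_of_le_one_left hm0.le (min_le_left _ _)
    · by_cases hj : j ∈ S
      · left; simp [glue, hj]
      · right
        rw [glue_of_notMem _ _ hj]
        linarith [hsq j, show (0 : ℝ) ≤ q j from hq0 j]

/-- The data that the analysis of the decomposed method depends on: `U` bounds the least fixed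
point from above, `s` bounds half of it from below. -/
structure IsBounded (Q : σ → MvPolynomial σ ℝ) (q : σ → ℝ) (s U : ℝ) : Prop where
  mps : IsMPS Q
  quad : IsQuadratic Q
  lfp : IsLFP Q q
  s_pos : 0 < s
  s_le : s ≤ 1
  s_le_q : ∀ i, s ≤ 1 / 2 * q i
  one_le_U : 1 ≤ U
  q_le : ∀ i, q i ≤ U
  cMin_pos : 0 < cMin Q

open Classical in
theorem IsBounded.rnm_subsystem {s U : ℝ} (hb : IsBounded Q q s U) {S : Finset σ}
    (hS : IsSCC Q S) {x : σ → ℝ} (hx0 : 0 ≤ x)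
    (hxq : ∀ i ∈ S, ∀ j ∈ (Q i).vars, j ∉ S → x j ≤ q j) {δ : ℝ} (hδ : 0 ≤ δ)
    (hxδ : ∀ i ∈ S, ∀ j ∈ (Q i).vars, j ∉ S → q j - x j ≤ δ) (h : ℤ) (g : ℕ) :
    (∀ m < (if IsLinearSCC Q q S then 1 else g), NewtonDefined (subsystem Q S x)
        (rnm (subsystem Q S x) h m)) ∧
      ∀ i : S, rnm (subsystem Q S x) h (if IsLinearSCC Q q S then 1 else g) i ≤ q i ∧
        q i - rnm (subsystem Q S x) h (if IsLinearSCC Q q S then 1 else g) i ≤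
          if IsLinearSCC Q q S then
            S.card * (U / (min 1 (cMin Q) * s) ^ 2 / (min 1 (cMin Q) * s) ^ S.card *
              (2 * U * ‖evalAt Q 1‖ * δ)) + (2 : ℝ) ^ (-h)
          else
            √(2 * S.card * (2 * U * ‖evalAt Q 1‖ * δ)
                / (min 1 (cMin Q) * s) ^ (3 * S.card + 1))
              + (U * (2 : ℝ)⁻¹ ^ g + 2 * (2 : ℝ) ^ (-h)) / (min 1 (cMin Q) * s) ^ S.card := by
  -- Only the variables entering S from below are known to satisfy x ≤ q, whereas the block needs
  -- this everywhere. Truncation at q does not change the subsystem.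
  have hsub : subsystem Q S x = subsystem Q S (x ⊓ q) := subsystem_congr fun i hi j hj hjS =>
    (min_eq_left (hxq i hi j hj hjS)).symm
  have hB := isPerturbedBlock_subsystem hb.mps hb.quad hb.lfp hb.s_pos hb.s_le hb.s_le_q
    hb.one_le_U hb.q_le hb.cMin_pos hS (y := x ⊓ q) (le_inf hx0 hb.lfp.1.1) inf_le_right hδ
    fun i hi j hj hjS => by
      have h1 := hxδ i hi j hj hjS
      have h2 : (x ⊓ q) j = x j := min_eq_left (hxq i hi j hj hjS)
      rw [h2]; exact h1
  rw [← hsub] at hB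
  have hne : Nonempty S := by
    obtain ⟨i, rfl⟩ := hS
    exact ⟨⟨i, self_mem_scc i⟩⟩
  by_cases hlin : IsLinearSCC Q q S
  · simp only [if_pos hlin]
    have hH : ∀ i j k : S, hess (subsystem Q S q) i j k = 0 := fun i j k => by
      rw [hess_subsystem hb.quad]; exact (isLinearSCC_iff hb.quad q).1 hlin i j k
    obtain ⟨h1, -, h2⟩ := hB.rnm_linear hH h
    refine ⟨fun m hm => ?_, fun i => ?_⟩
    · obtain rfl : m = 0 := by omega
      exact h1
    · simpa only [Fintype.card_coe] using h2 i
  · simp only [if_neg hlin]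
    have hlin' := hlin
    rw [isLinearSCC_iff hb.quad q] at hlin'
    push Not at hlin'
    obtain ⟨i₀, j₀, k₀, hH⟩ := hlin'
    rw [← hess_subsystem hb.quad q] at hH
    refine ⟨fun m _ => (hB.rnm_nonlinear hH h m).1, fun i => ?_⟩
    simpa only [Fintype.card_coe] using (hB.rnm_nonlinear hH h g).2.2 i

end Blocks

section Output

variable {σ : Type*} [Fintype σ] [DecidableEq σ] {Q : σ → MvPolynomial σ ℝ} {q : σ → ℝ}

/-- A map whose value at `i` depends only on the arguments of smaller rank has a unique fixed
point. -/
theorem existsUnique_of_rank {σ α : Type*} (r : σ → ℕ) (Φ : (σ → α) → σ → α) [Inhabited α]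
    (hΦ : ∀ y y' i, (∀ j, r j < r i → y j = y' j) → Φ y i = Φ y' i) :
    ∃! x : σ → α, ∀ i, x i = Φ x i := by
  classical
  have wf : WellFounded fun a b : σ => r a < r b := (measure r).wf
  refine ⟨wf.fix fun i rec => Φ (fun j => if hj : r j < r i then rec j hj else default) i,
    fun i => ?_, fun y hy => funext fun i => ?_⟩
  · rw [wf.fix_eq]
    exact hΦ _ _ i fun j hj => by rw [dif_pos hj]
  · induction i using wf.induction with
    | _ i ih =>
      rw [hy, wf.fix_eq]
      exact hΦ _ _ i fun j hj => by rw [dif_pos hj, ih j hj]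

open Classical in
/-- One sweep of the decomposed method, all components being updated at once. -/
noncomputable def sweep (Q : σ → MvPolynomial σ ℝ) (q : σ → ℝ) (g : ℕ) (h : ℤ) (y : σ → ℝ)
    (S : Finset σ) (i : σ) : ℝ :=
  if hi : i ∈ S then rnm (subsystem Q S y) h (if IsLinearSCC Q q S then 1 else g) ⟨i, hi⟩ else 0

theorem sweep_congr {g : ℕ} {h : ℤ} (y y' : σ → ℝ) (i : σ)
    (hy : ∀ j, rank Q j < rank Q i → y j = y' j) :
    sweep Q q g h y (scc Q i) i = sweep Q q g h y' (scc Q i) i := by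
  unfold sweep
  rw [subsystem_congr fun k hk j hj hjS => hy j (rank_lt_of_mem_vars hk hj hjS)]

theorem IsRDNMOutput.eq_sweep {g : ℕ} {h : ℤ} {x : σ → ℝ} (hx : IsRDNMOutput Q q g h x)
    (i : σ) : x i = sweep Q q g h x (scc Q i) i := by
  have := congrFun (hx (scc Q i) ⟨i, rfl⟩).2 ⟨i, self_mem_scc i⟩
  unfold sweep
  rw [dif_pos (self_mem_scc i)]
  exact this

omit [Fintype σ] in
theorem sweep_nonneg (g : ℕ) (h : ℤ) (y : σ → ℝ) (S : Finset σ) (i : σ) :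
    0 ≤ sweep Q q g h y S i := by
  unfold sweep
  split_ifs
  · exact roundDown_nonneg _ _
  · generalize g = k
    cases k with
    | zero => exact le_rfl
    | succ k => exact roundDown_nonneg _ _
  · exact le_rfl

theorem IsBounded.le_of_eq_sweep {s U : ℝ} (hb : IsBounded Q q s U) {g : ℕ} {h : ℤ} {x : σ → ℝ}
    (hx : ∀ i, x i = sweep Q q g h x (scc Q i) i) : x ≤ q := by
  have hx0 : 0 ≤ x := fun i => by rw [hx]; exact sweep_nonneg _ _ _ _ _
  intro i
  induction hn : rank Q i using Nat.strong_induction_on generalizing i with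
  | _ n ih =>
    have := (hb.rnm_subsystem (S := scc Q i) ⟨i, rfl⟩ hx0
      (fun k hk j hj hjS => ih _ (hn ▸ rank_lt_of_mem_vars hk hj hjS) j rfl)
      -- The trivial error bound δ = U suffices, since only the upper bound by q is used.
      (zero_le_one.trans hb.one_le_U)
      (fun k hk j hj hjS => by
        have h1 : 0 ≤ x j := hx0 j
        have h2 := hb.q_le j
        linarith) h g).2 ⟨i, self_mem_scc i⟩
    rw [hx]
    unfold sweep
    rw [dif_pos (self_mem_scc i)]
    exact this.1

open Classical in
/-- The decomposed method is always defined, its result is unique and a lower bound on the least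
fixed point, and on each component its error is controlled by the error on the components below. -/
theorem IsBounded.exists_output {s U : ℝ} (hb : IsBounded Q q s U) (g : ℕ) (h : ℤ) :
    ∃ x : σ → ℝ, IsRDNMOutput Q q g h x ∧ (∀ y, IsRDNMOutput Q q g h y → y = x) ∧
      0 ≤ x ∧ x ≤ q ∧
      ∀ S, IsSCC Q S → ∀ δ, 0 ≤ δ →
        (∀ i ∈ S, ∀ j ∈ (Q i).vars, j ∉ S → q j - x j ≤ δ) → ∀ i ∈ S, q i - x i ≤
          if IsLinearSCC Q q S then
            S.card * (U / (min 1 (cMin Q) * s) ^ 2 / (min 1 (cMin Q) * s) ^ S.card *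
              (2 * U * ‖evalAt Q 1‖ * δ)) + (2 : ℝ) ^ (-h)
          else
            √(2 * S.card * (2 * U * ‖evalAt Q 1‖ * δ)
                / (min 1 (cMin Q) * s) ^ (3 * S.card + 1))
              + (U * (2 : ℝ)⁻¹ ^ g + 2 * (2 : ℝ) ^ (-h)) / (min 1 (cMin Q) * s) ^ S.card := by
  obtain ⟨x, hx, huniq⟩ := existsUnique_of_rank (rank Q)
    (fun y i => sweep Q q g h y (scc Q i) i) sweep_congr
  have hx0 : 0 ≤ x := fun i => by rw [hx i]; exact sweep_nonneg _ _ _ _ _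
  have hxq : x ≤ q := hb.le_of_eq_sweep hx
  have hxS : ∀ S, IsSCC Q S → (fun i : S => x i)
      = rnm (subsystem Q S x) h (if IsLinearSCC Q q S then 1 else g) := by
    intro S hS
    funext ⟨i, hi⟩
    obtain rfl := hS.eq_scc hi
    change x i = _
    rw [hx i]
    dsimp only [sweep]
    rw [dif_pos hi]
  refine ⟨x, fun S hS => ⟨?_, hxS S hS⟩, fun y hy => huniq y hy.eq_sweep, hx0, hxq,
    fun S hS δ hδ hSδ i hi => ?_⟩
  · exact (hb.rnm_subsystem hS hx0 (fun i _ j _ _ => hxq j) (zero_le_one.trans hb.one_le_U)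
      (fun k hk j hj hjS => by
        have h1 : 0 ≤ x j := hx0 j
        have h2 := hb.q_le j
        linarith) h g).1
  · have h1 := ((hb.rnm_subsystem hS hx0 (fun i _ j _ _ => hxq j) hδ hSδ h g).2 ⟨i, hi⟩).2
    have h2 := congrFun (hxS S hS) ⟨i, hi⟩
    rw [← h2] at h1
    exact h1

end Output

end MPS

/-! ### Error propagation along paths of components -/

namespace MPS

section Paths

variable {σ : Type*} [Fintype σ] {Q : σ → MvPolynomial σ ℝ}

/-- Rank certifies acyclicity. Paths therefore have no repeated node and bounded length, so the
suprema defining the two depths are over bounded sets. -/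
theorem sup_rank_lt_of_sccEdge {S T : Finset σ} (hS : IsSCC Q S) (hT : IsSCC Q T)
    (h : SCCEdge Q S T) : T.sup (rank Q) < S.sup (rank Q) := by
  obtain ⟨hne, i, hi, j, hj, hij⟩ := h
  obtain rfl := hS.eq_scc hi
  obtain rfl := hT.eq_scc hj
  have h1 : rank Q j < rank Q i := rank_lt_of_mem_vars hi hij fun hmem =>
    hne (scc_eq_of_mem hmem).symm
  have h2 : (scc Q j).sup (rank Q) ≤ rank Q j :=
    Finset.sup_le fun k hk => rank_le_of_reach (mem_scc.1 hk).1
  exact h2.trans_lt (h1.trans_le (Finset.le_sup (f := rank Q) hi))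

theorem IsSCCPath.nodup {l : List (Finset σ)} (hl : IsSCCPath Q l) : l.Nodup := by
  have h1 : l.IsChain fun S T => T.sup (rank Q) < S.sup (rank Q) :=
    hl.2.imp_of_mem_imp fun S T hS hT h => sup_rank_lt_of_sccEdge (hl.1 S hS) (hl.1 T hT) h
  have h2 : (l.map fun S => S.sup (rank Q)).IsChain (· > ·) := (List.isChain_map _).2 h1
  exact List.Nodup.of_map _ (h2.pairwise.imp fun h => ne_of_gt h)

theorem IsSCCPath.length_le_depth {l : List (Finset σ)} (hl : IsSCCPath Q l) :
    l.length ≤ depth Q :=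
  le_csSup ⟨Fintype.card (Finset σ), by
    rintro _ ⟨l, hl, rfl⟩
    exact hl.nodup.length_le_card⟩ ⟨l, hl, rfl⟩

open Classical in
theorem IsSCCPath.length_filter_le_nonlinearDepth [DecidableEq σ] {l : List (Finset σ)} (q : σ → ℝ)
    (hl : IsSCCPath Q l) :
    (l.filter fun S => ¬ IsLinearSCC Q q S).length ≤ nonlinearDepth Q q :=
  le_csSup ⟨Fintype.card (Finset σ), by
    rintro _ ⟨l, hl, rfl⟩
    exact (List.length_filter_le _ _).trans hl.nodup.length_le_card⟩
    ⟨l, hl, by congr!⟩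

theorem isSCCPath_singleton (i : σ) : IsSCCPath Q [scc Q i] :=
  ⟨by simpa using ⟨i, rfl⟩, List.isChain_singleton _⟩

theorem IsSCCPath.append_scc {l : List (Finset σ)} {i j k : σ}
    (hl : IsSCCPath Q (l ++ [scc Q i])) (hk : k ∈ scc Q i) (hj : j ∈ (Q k).vars)
    (hjS : j ∉ scc Q i) : IsSCCPath Q ((l ++ [scc Q i]) ++ [scc Q j]) := by
  refine ⟨fun S hS => ?_, List.isChain_append.2 ⟨hl.2, List.isChain_singleton _, ?_⟩⟩
  · rcases List.mem_append.1 hS with h | h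
    · exact hl.1 S h
    · exact ⟨j, List.mem_singleton.1 h⟩
  · intro S hS T hT
    obtain rfl : scc Q i = S := by simpa using hS
    obtain rfl : scc Q j = T := by simpa using hT
    exact ⟨fun h => hjS (h ▸ self_mem_scc j), k, hk, j, self_mem_scc j, hj⟩

end Paths

section Recursion

variable {σ : Type*} [Fintype σ] [DecidableEq σ] {Q : σ → MvPolynomial σ ℝ} {q : σ → ℝ}

open Classical in
/-- Propagation of the error through the components, along the paths leading to a component. -/
theorem sub_le_of_component_bound {U e K : ℝ} {d f : ℕ} (hd : d = depth Q)
    (hf : f = nonlinearDepth Q q) (hU : 0 < U) (he : 0 < e) (he1 : e ≤ 1) (hK : 1 ≤ K) {x : σ → ℝ}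
    (hstep : ∀ S, IsSCC Q S → ∀ t, 0 ≤ t → (e / K ^ d) ^ 2 ^ f ≤ t →
      (∀ i ∈ S, ∀ j ∈ (Q i).vars, j ∉ S →
        q j - x j ≤ if IsLinearSCC Q q S then U * t else U * t ^ 2) →
      ∀ i ∈ S, q i - x i ≤ U * (t * K)) (i : σ) : q i - x i ≤ U * e := by
  have key : ∀ (r : ℕ) (i : σ), rank Q i = r → ∀ l, IsSCCPath Q (l ++ [scc Q i]) →
      q i - x i ≤
        U * (e / K ^ l.length) ^ 2 ^ (l.filter fun S => ¬ IsLinearSCC Q q S).length := by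
    intro r
    induction r using Nat.strong_induction_on with
    | _ r ih =>
      intro i hi l hl
      set S := scc Q i with hS
      set a := l.length with ha
      set m := (l.filter fun S => ¬ IsLinearSCC Q q S).length with hm
      have hK0 : 0 < K := one_pos.trans_le hK
      have hda : a + 1 ≤ d := by
        have := hl.length_le_depth
        rw [← hd] at this
        simpa using this
      have hfm : m + (if IsLinearSCC Q q S then 0 else 1) ≤ f := by
        have := hl.length_filter_le_nonlinearDepth q
        rw [← hf, List.filter_append, List.length_append] at this
        convert this using 2
        split_ifs with h <;> simp [h]
      have hmf : m ≤ f := (Nat.le_add_right _ _).trans hfm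
      have hKa : ∀ b, e / K ^ b ≤ 1 := fun b =>
        (div_le_self he.le (one_le_pow₀ hK)).trans he1
      -- Appending S to the path turns the demand on lower components into U t if S is linear and U
      -- t² if not. The factor K lost on S is regained because K ≤ K^(2^m).
      have h1 := hstep S ⟨i, rfl⟩ ((e / K ^ (a + 1)) ^ 2 ^ m) (by positivity) ?_ ?_ i
        (self_mem_scc i)
      · refine h1.trans (mul_le_mul_of_nonneg_left ?_ hU.le)
        have h2 : e / K ^ a = e / K ^ (a + 1) * K := by
          rw [pow_succ]; field_simp
        rw [h2, mul_pow]
        exact mul_le_mul_of_nonneg_left (le_self_pow₀ hK (by positivity)) (by positivity)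
      · calc (e / K ^ d) ^ 2 ^ f ≤ (e / K ^ (a + 1)) ^ 2 ^ f := by
              refine pow_le_pow_left₀ (by positivity) ?_ _
              exact div_le_div_of_nonneg_left he.le (by positivity) (pow_le_pow_right₀ hK hda)
          _ ≤ _ := pow_le_pow_of_le_one (by positivity) (hKa _)
              (Nat.pow_le_pow_right two_pos hmf)
      · intro k hk j hj hjS
        have h3 := ih (rank Q j) (hi ▸ rank_lt_of_mem_vars hk hj hjS) j rfl
          (l ++ [S]) (hl.append_scc hk hj hjS)
        rw [List.length_append, List.length_singleton, List.filter_append,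
          List.length_append] at h3
        refine h3.trans (le_of_eq ?_)
        by_cases hlin : IsLinearSCC Q q S
        · simp [hlin, ha, hm]
        · simp [hlin, ha, hm, pow_succ, pow_mul]
  simpa using key _ i rfl [] (isSCCPath_singleton i)

open Classical in
theorem IsBounded.sub_le {s U : ℝ} (hb : IsBounded Q q s U) {e K : ℝ} {d f : ℕ}
    (hd : d = depth Q) (hf : f = nonlinearDepth Q q) (he : 0 < e) (he1 : e ≤ 1)
    (hK : 1 ≤ K) {β R : ℝ} (hβ : β = min 1 (cMin Q) * s)
    (hKlin : ∀ k ≤ Fintype.card σ, k * (U / β ^ 2 / β ^ k * (2 * U * R)) ≤ K / 2)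
    (hKnl : ∀ k ≤ Fintype.card σ, 2 * k * (2 * U * R) / β ^ (3 * k + 1) ≤ U * K ^ 2 / 4)
    (hKβ : ∀ k ≤ Fintype.card σ, 1 / β ^ k ≤ K) {g : ℕ} {h : ℤ}
    (hg : (2 : ℝ)⁻¹ ^ g ≤ (e / K ^ d) ^ 2 ^ f / 4) (hh : (2 : ℝ) ^ (-h) = U * (2 : ℝ)⁻¹ ^ g / 2)
    {x : σ → ℝ}
    (hx : ∀ S, IsSCC Q S → ∀ δ, 0 ≤ δ →
      (∀ i ∈ S, ∀ j ∈ (Q i).vars, j ∉ S → q j - x j ≤ δ) → ∀ i ∈ S, q i - x i ≤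
        if IsLinearSCC Q q S then
          S.card * (U / β ^ 2 / β ^ S.card * (2 * U * R * δ)) + (2 : ℝ) ^ (-h)
        else
          √(2 * S.card * (2 * U * R * δ) / β ^ (3 * S.card + 1))
            + (U * (2 : ℝ)⁻¹ ^ g + 2 * (2 : ℝ) ^ (-h)) / β ^ S.card) (i : σ) :
    q i - x i ≤ U * e := by
  have hU : 0 < U := one_pos.trans_le hb.one_le_U
  have hβ0 : 0 < β := by
    rw [hβ]; exact mul_pos (lt_min one_pos hb.cMin_pos) hb.s_pos
  refine sub_le_of_component_bound hd hf hU he he1 hK (fun S hS t ht hΘ hSt i hi => ?_) i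
  have hcard := S.card_le_univ
  -- Half of the budget U t K goes to the inherited error, half to iteration and rounding. On a
  -- nonlinear component U 2^(-g) + 2·2^(-h) = 2U 2^(-g) ≤ U t/2.
  have hgt : (2 : ℝ)⁻¹ ^ g ≤ t / 4 := by linarith
  have hUg : U * (2 : ℝ)⁻¹ ^ g ≤ U * (t / 4) := mul_le_mul_of_nonneg_left hgt hU.le
  have hUt : 0 ≤ U * t := by positivity
  by_cases hlin : IsLinearSCC Q q S
  · simp only [if_pos hlin] at hSt
    have h1 := hx S hS _ hUt hSt i hi
    rw [if_pos hlin, hh] at h1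
    have h2 := mul_le_mul_of_nonneg_right (hKlin _ hcard) hUt
    have h3 : U * t ≤ U * t * K := le_mul_of_one_le_right hUt hK
    have h4 : (S.card : ℝ) * (U / β ^ 2 / β ^ S.card * (2 * U * R * (U * t)))
        = S.card * (U / β ^ 2 / β ^ S.card * (2 * U * R)) * (U * t) := by ring
    rw [h4] at h1
    linarith
  · simp only [if_neg hlin] at hSt
    have h1 := hx S hS _ (by positivity) hSt i hi
    rw [if_neg hlin, hh] at h1
    have h2 : √(2 * S.card * (2 * U * R * (U * t ^ 2)) / β ^ (3 * S.card + 1))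
        ≤ U * t * K / 2 := by
      refine Real.sqrt_le_iff.2 ⟨by positivity, ?_⟩
      have := mul_le_mul_of_nonneg_right (hKnl _ hcard) (by positivity : 0 ≤ U * t ^ 2)
      calc _ = 2 * S.card * (2 * U * R) / β ^ (3 * S.card + 1) * (U * t ^ 2) := by ring
        _ ≤ _ := this
        _ = _ := by ring
    have h3 : (U * (2 : ℝ)⁻¹ ^ g + 2 * (U * (2 : ℝ)⁻¹ ^ g / 2)) / β ^ S.card
        ≤ U * t * K / 2 := by
      calc _ = 2 * (U * (2 : ℝ)⁻¹ ^ g) * (1 / β ^ S.card) := by ring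
        _ ≤ 2 * (U * (t / 4)) * K :=
          mul_le_mul (by linarith) (hKβ _ hcard) (by positivity) (by positivity)
        _ = _ := by ring
    linarith

end Recursion

end MPS

/-! ### The constants and the main theorem -/

namespace MPS

theorem constant_bounds {n : ℕ} (hn : 0 < n) {β U R K : ℝ} (hβ : 0 < β) (hβ1 : β ≤ 1)
    (hU : 1 ≤ U) (hR : 2 * β ≤ U ^ 2 * R)
    (hK : K = 16 * n * R * U * ((β / U ^ 2) ^ (4 * n + 1))⁻¹) :
    U ≤ K ∧ (∀ k ≤ n, (k : ℝ) * (U / β ^ 2 / β ^ k * (2 * U * R)) ≤ K / 2) ∧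
    (∀ k ≤ n, 2 * (k : ℝ) * (2 * U * R) / β ^ (3 * k + 1) ≤ U * K ^ 2 / 4) ∧
    ∀ k ≤ n, 1 / β ^ k ≤ K := by
  have hU0 : 0 < U := one_pos.trans_le hU
  have hR0 : 0 < R := by
    by_contra! h
    have := mul_nonpos_of_nonneg_of_nonpos (sq_nonneg U) h
    linarith
  have hn1 : (1 : ℝ) ≤ n := by exact_mod_cast hn
  have hU2 : 1 ≤ U ^ 2 := one_le_pow₀ hU
  -- Of the many factors U² in the inverse power only one is needed.
  have hKW : 16 * n * R * U ^ 3 * (β ^ (4 * n + 1))⁻¹ ≤ K := by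
    have h1 : (β / U ^ 2) ^ (4 * n + 1) ≤ β ^ (4 * n + 1) / U ^ 2 := by
      rw [div_pow]
      exact div_le_div_of_nonneg_left (by positivity) (by positivity)
        (le_self_pow₀ hU2 (by omega))
    have h2 : (β ^ (4 * n + 1) / U ^ 2)⁻¹ ≤ ((β / U ^ 2) ^ (4 * n + 1))⁻¹ :=
      inv_anti₀ (by positivity) h1
    rw [hK]
    calc _ = 16 * n * R * U * (β ^ (4 * n + 1) / U ^ 2)⁻¹ := by
          rw [inv_div]; ring
      _ ≤ _ := by gcongr
  have hW : ∀ j ≤ 4 * n + 1, (β ^ j)⁻¹ ≤ (β ^ (4 * n + 1))⁻¹ := fun j hj =>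
    inv_anti₀ (by positivity) (pow_le_pow_of_le_one hβ.le hβ1 hj)
  -- R may be small; one of the 4n+1 factors 1/β is spent on its lower bound 2β ≤ U² R.
  have hβK : ∀ j ≤ 4 * n, U * (β ^ j)⁻¹ ≤ K := by
    intro j hj
    calc U * (β ^ j)⁻¹ ≤ U * (β ^ (4 * n))⁻¹ := by
          refine mul_le_mul_of_nonneg_left ?_ hU0.le
          exact inv_anti₀ (by positivity) (pow_le_pow_of_le_one hβ.le hβ1 hj)
      _ = 2 * β * (U * (β ^ (4 * n + 1))⁻¹) / 2 := by
          rw [pow_succ]; field_simp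
      _ ≤ U ^ 2 * R * (U * (β ^ (4 * n + 1))⁻¹) / 2 := by gcongr
      _ = 1 / 2 * (R * U ^ 3 * (β ^ (4 * n + 1))⁻¹) := by ring
      _ ≤ 16 * n * (R * U ^ 3 * (β ^ (4 * n + 1))⁻¹) := by
          refine mul_le_mul_of_nonneg_right (by linarith) (by positivity)
      _ = 16 * n * R * U ^ 3 * (β ^ (4 * n + 1))⁻¹ := by ring
      _ ≤ K := hKW
  have hUK : U ≤ K := by simpa using hβK 0 (by omega)
  have hK1 : 1 ≤ K := hU.trans hUK
  have hcoef : ∀ k ≤ n, ∀ j ≤ 4 * n + 1, ∀ m ≤ 3,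
      4 * (k : ℝ) * (R * U ^ m * (β ^ j)⁻¹) ≤ K / 4 := by
    intro k hk j hj m hm
    have hk' : (k : ℝ) ≤ n := by exact_mod_cast hk
    calc 4 * (k : ℝ) * (R * U ^ m * (β ^ j)⁻¹)
        ≤ 4 * n * (R * U ^ 3 * (β ^ (4 * n + 1))⁻¹) := by
          have := hW j hj
          have := pow_le_pow_right₀ hU hm
          gcongr
      _ = (16 * n * R * U ^ 3 * (β ^ (4 * n + 1))⁻¹) / 4 := by ring
      _ ≤ K / 4 := by linarith
  refine ⟨hUK, fun k hk => ?_, fun k hk => ?_, fun k hk => ?_⟩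
  · have h1 := hcoef k hk (k + 2) (by omega) 2 (by omega)
    have h2 : (k : ℝ) * (U / β ^ 2 / β ^ k * (2 * U * R))
        = 1 / 2 * (4 * (k : ℝ) * (R * U ^ 2 * (β ^ (k + 2))⁻¹)) := by
      rw [pow_add]; field_simp; ring
    rw [h2]
    linarith
  · have h1 := hcoef k hk (3 * k + 1) (by omega) 1 (by omega)
    have h2 : 2 * (k : ℝ) * (2 * U * R) / β ^ (3 * k + 1)
        = 4 * (k : ℝ) * (R * U ^ 1 * (β ^ (3 * k + 1))⁻¹) := by
      rw [pow_one]; field_simp; ring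
    rw [h2]
    nlinarith
  · have h1 := hβK k (by omega)
    rw [one_div]
    exact (le_mul_of_one_le_left (by positivity) hU).trans h1

end MPS

theorem theorem4 {n : ℕ} (hn : 0 < n) (Q : Fin n → MvPolynomial (Fin n) ℝ)
    (hQ : MPS.IsMPS Q) (hQ2 : MPS.IsQuadratic Q)
    (q : Fin n → ℝ) (hq : MPS.IsLFP Q q) (hqpos : ∀ i, 0 < q i)
    (ε : ℝ) (hε : 0 < ε)
    (d f : ℕ) (hd : d = MPS.depth Q) (hf : f = MPS.nonlinearDepth Q q)
    (u : ℤ) (hu : u = max 0 ⌈Real.logb 2 (⨆ i, q i)⌉)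
    (α : ℝ)
    (hα : α = (2 : ℝ) ^ (-2 * u) * min 1 (MPS.cMin Q) * min 1 (1 / 2 * ⨅ i, q i))
    (g h : ℤ)
    (hg : g = 2 + ⌈(2 : ℝ) ^ f * (Real.logb 2 (1 / ε) +
      d * (2 * u + Real.logb 2 (α ^ (-(4 * (n : ℤ) + 1))) + Real.logb 2 (16 * n) +
        Real.logb 2 ‖MPS.evalAt Q 1‖))⌉)
    (hh : h = g + 1 - u) :
    (ε < (2 : ℝ) ^ u → 0 < g ∧ 0 < h) ∧
    ∃ x : Fin n → ℝ,
      MPS.IsRDNMOutput Q q g.toNat h x ∧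
      (∀ y, MPS.IsRDNMOutput Q q g.toNat h y → y = x) ∧
      ‖q - x‖ ≤ ε := by
  have : Nonempty (Fin n) := ⟨⟨0, hn⟩⟩
  set i₀ : Fin n := ⟨0, hn⟩
  -- the bounds on the least fixed point
  set U : ℝ := (2 : ℝ) ^ u with hU
  have hu0 : 0 ≤ u := hu ▸ le_max_left _ _
  have hU1 : 1 ≤ U := one_le_zpow₀ one_le_two hu0
  have hU0 : 0 < U := one_pos.trans_le hU1
  have hlogU : Real.logb 2 U = u := by
    rw [hU, ← Real.rpow_intCast, Real.logb_rpow two_pos (by norm_num)]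
  have hqU : ∀ i, q i ≤ U := by
    intro i
    have h1 : q i ≤ ⨆ i, q i := le_ciSup (Finite.bddAbove_range q) i
    have h2 : Real.logb 2 (⨆ i, q i) ≤ Real.logb 2 U := by
      rw [hlogU]
      refine (Int.le_ceil _).trans ?_
      exact_mod_cast hu ▸ le_max_right _ _
    exact h1.trans ((Real.logb_le_logb one_lt_two ((hqpos i).trans_le h1) hU0).1 h2)
  set s : ℝ := min 1 (1 / 2 * ⨅ i, q i) with hs
  have hinf : ∀ i, (⨅ i, q i) ≤ q i := fun i => ciInf_le (Finite.bddBelow_range q) i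
  have hs0 : 0 < s := by
    obtain ⟨i, hi⟩ := exists_eq_ciInf_of_finite (f := q)
    refine lt_min one_pos ?_
    rw [← hi]
    exact mul_pos (by norm_num) (hqpos i)
  have hs1 : s ≤ 1 := min_le_left _ _
  have hsq : ∀ i, s ≤ 1 / 2 * q i := fun i =>
    (min_le_right _ _).trans (mul_le_mul_of_nonneg_left (hinf i) (by norm_num))
  -- A positive coefficient exists because q > 0; otherwise the infimum would be that of the empty
  -- set, 0.
  have hc : 0 < MPS.cMin Q := by
    have h1 : MvPolynomial.eval q (Q i₀) ≠ 0 := by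
      rw [show MvPolynomial.eval q (Q i₀) = q i₀ from congrFun hq.1.2 i₀]
      exact (hqpos i₀).ne'
    have h2 : Q i₀ ≠ 0 := fun h0 => h1 (by rw [h0, map_zero])
    obtain ⟨m, hm⟩ := MvPolynomial.ne_zero_iff.1 h2
    exact MPS.cMin_pos (lt_of_le_of_ne (hQ i₀ m) hm.symm)
  have hb : MPS.IsBounded Q q s U := ⟨hQ, hQ2, hq, hs0, hs1, hsq, hU1, hqU, hc⟩
  -- the constants
  set β : ℝ := min 1 (MPS.cMin Q) * s with hβ
  have hβ0 : 0 < β := mul_pos (lt_min one_pos hc) hs0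
  have hβs : β ≤ s := mul_le_of_le_one_left hs0.le (min_le_left _ _)
  have hβ1 : β ≤ 1 := hβs.trans hs1
  have hαβ : α = β / U ^ 2 := by
    rw [hα, hβ, hU, mul_comm (-2) u, zpow_mul, zpow_neg, zpow_ofNat]
    ring
  set R : ℝ := ‖MPS.evalAt Q 1‖ with hR
  -- 2β ≤ 2s ≤ q_i = Q_i(q) ≤ U² Q_i(1).
  have hβR : 2 * β ≤ U ^ 2 * R := by
    have h1 := MPS.evalAt_le_sq_mul hQ hQ2 hU1 hq.1.1 hqU i₀
    rw [hq.1.2] at h1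
    have h2 : MPS.evalAt Q 1 i₀ ≤ R := (Real.le_norm_self _).trans (norm_le_pi_norm _ i₀)
    have h3 := mul_le_mul_of_nonneg_left h2 (sq_nonneg U)
    have h4 := hsq i₀
    linarith
  have hR0 : 0 < R := by
    by_contra! h0
    have := mul_nonpos_of_nonneg_of_nonpos (sq_nonneg U) h0
    linarith
  set K : ℝ := 16 * n * R * U * ((β / U ^ 2) ^ (4 * n + 1))⁻¹ with hK
  obtain ⟨hUK, hKlin, hKnl, hKβ⟩ := MPS.constant_bounds hn hβ0 hβ1 hU1 hβR hK
  have hK1 : 1 ≤ K := hU1.trans hUK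
  have hK0 : 0 < K := one_pos.trans_le hK1
  have hαpow : α ^ (-(4 * (n : ℤ) + 1)) = ((β / U ^ 2) ^ (4 * n + 1))⁻¹ := by
    rw [zpow_neg, hαβ]
    congr 1
  -- One u belongs to K; the other is a spare factor U per component, from which the final rescaling
  -- e = ε/U is paid.
  have hlog : 2 * (u : ℝ) + Real.logb 2 (α ^ (-(4 * (n : ℤ) + 1))) + Real.logb 2 (16 * n)
      + Real.logb 2 R = Real.logb 2 (K * U) := by
    have hA : ((β / U ^ 2) ^ (4 * n + 1))⁻¹ ≠ 0 := by positivity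
    have h16 : (16 * n : ℝ) ≠ 0 := by positivity
    rw [hαpow, hK, Real.logb_mul (by positivity) hU0.ne', Real.logb_mul (by positivity) hA,
      Real.logb_mul (by positivity) hU0.ne', Real.logb_mul h16 hR0.ne', hlogU]
    ring
  rw [hlog] at hg
  have hd1 : 1 ≤ d := by
    rw [hd]
    exact (MPS.isSCCPath_singleton (Q := Q) i₀).length_le_depth
  have hlogK : u + (u : ℝ) ≤ Real.logb 2 (K * U) := by
    rw [← hlogU, ← Real.logb_mul hU0.ne' hU0.ne']
    exact (Real.logb_le_logb one_lt_two (by positivity) (by positivity)).2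
      (mul_le_mul_of_nonneg_right hUK hU0.le)
  have huR : (0 : ℝ) ≤ u := by exact_mod_cast hu0
  have hdlog : Real.logb 2 (K * U) ≤ d * Real.logb 2 (K * U) :=
    le_mul_of_one_le_left (by linarith) (by exact_mod_cast hd1)
  -- Here log(1/ε) ≥ -u, while d log(KU) ≥ 2u because d ≥ 1 and K ≥ U.
  have hglow : ε < U → u + 2 ≤ g := by
    intro hεU
    have h1 : -(u : ℝ) ≤ Real.logb 2 (1 / ε) := by
      rw [one_div, Real.logb_inv, ← hlogU]
      exact neg_le_neg ((Real.logb_le_logb one_lt_two hε hU0).2 hεU.le)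
    have h2 : (u : ℝ) ≤ (2 : ℝ) ^ f * (Real.logb 2 (1 / ε) + d * Real.logb 2 (K * U)) := by
      have h3 : (u : ℝ) ≤ Real.logb 2 (1 / ε) + d * Real.logb 2 (K * U) := by linarith
      exact h3.trans (le_mul_of_one_le_left (huR.trans h3) (one_le_pow₀ one_le_two))
    have h4 : (u : ℝ) ≤ (⌈(2 : ℝ) ^ f * (Real.logb 2 (1 / ε) + d * Real.logb 2 (K * U))⌉ : ℤ) :=
      h2.trans (Int.le_ceil _)
    have h5 : u ≤ ⌈(2 : ℝ) ^ f * (Real.logb 2 (1 / ε) + d * Real.logb 2 (K * U))⌉ := by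
      exact_mod_cast h4
    omega
  refine ⟨fun hεU => by have := hglow hεU; omega, ?_⟩
  obtain ⟨x, hx, huniq, hx0, hxq, hstep⟩ := hb.exists_output g.toNat h
  refine ⟨x, hx, huniq, ?_⟩
  have hnorm : ∀ C : ℝ, 0 ≤ C → (∀ i, q i - x i ≤ C) → ‖q - x‖ ≤ C := fun C hC hle => by
    refine (pi_norm_le_iff_of_nonneg hC).2 fun i => ?_
    rw [Pi.sub_apply, Real.norm_of_nonneg (sub_nonneg.2 (hxq i))]
    exact hle i
  -- If ε ≥ U, any output between 0 and q is accurate enough, whatever the number of iterations.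
  rcases le_or_gt U ε with hεU | hεU
  · refine hnorm ε hε.le fun i => ?_
    have h1 : 0 ≤ x i := hx0 i
    linarith [hqU i]
  · have hg2 := hglow hεU
    have hgN : ((g.toNat : ℕ) : ℤ) = g := Int.toNat_of_nonneg (by omega)
    have hpow : (2 : ℝ)⁻¹ ^ g.toNat = (2 : ℝ) ^ (-g) := by
      rw [inv_pow, zpow_neg, ← zpow_natCast, hgN]
    have hmain : (2 : ℝ)⁻¹ ^ g.toNat ≤ (ε / U / K ^ d) ^ 2 ^ f / 4 := by
      set L : ℝ := Real.logb 2 (1 / ε) + d * Real.logb 2 (K * U) with hL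
      have hLeq : L = Real.logb 2 ((K * U) ^ d / ε) := by
        rw [Real.logb_div (by positivity) hε.ne', Real.logb_pow, hL, one_div, Real.logb_inv]
        ring
      have h1 : (2 : ℝ) ^ f * L ≤ ((g - 2 : ℤ) : ℝ) := by
        have := Int.le_ceil ((2 : ℝ) ^ f * L)
        have h2 : g - 2 = ⌈(2 : ℝ) ^ f * L⌉ := by omega
        rw [h2]; exact this
      have h3 : ((K * U) ^ d / ε) ^ 2 ^ f ≤ (2 : ℝ) ^ (g - 2) := by
        rw [← Real.rpow_intCast, ← Real.logb_le_iff_le_rpow one_lt_two (by positivity),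
          Real.logb_pow, ← hLeq]
        push_cast at h1 ⊢
        exact h1
      -- Only one of the d factors U is needed, and d ≥ 1. The summand 2 in g supplies the quarter.
      have h4 : (K ^ d * U / ε) ^ 2 ^ f ≤ ((K * U) ^ d / ε) ^ 2 ^ f := by
        refine pow_le_pow_left₀ (by positivity) ?_ _
        rw [mul_pow K U]
        have := le_self_pow₀ hU1 (by omega : d ≠ 0)
        gcongr
      have h5 := h4.trans h3
      have h6 : ε / U / K ^ d = (K ^ d * U / ε)⁻¹ := by
        rw [inv_div]; field_simp
      have h7 : (2 : ℝ) ^ (-g) = ((2 : ℝ) ^ (g - 2))⁻¹ / 4 := by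
        rw [zpow_sub₀ two_ne_zero, zpow_neg, inv_div]
        norm_num
        ring
      rw [hpow, h6, inv_pow, h7]
      exact div_le_div_of_nonneg_right (inv_anti₀ (by positivity) h5) (by norm_num)
    have hround : (2 : ℝ) ^ (-h) = U * (2 : ℝ)⁻¹ ^ g.toNat / 2 := by
      rw [hpow, hh, hU, show -(g + 1 - u) = u + -g - 1 by ring, zpow_sub₀ two_ne_zero,
        zpow_add₀ two_ne_zero, zpow_one]
    have hfin := hb.sub_le (e := ε / U) (K := K) (d := d) (f := f) (β := β) (R := R)
      (g := g.toNat) (h := h) (x := x) hd hf (by positivity)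
      ((div_le_one hU0).2 hεU.le) hK1 hβ (by simpa using hKlin) (by simpa using hKnl)
      (by simpa using hKβ) hmain hround hstep
    refine hnorm ε hε.le fun i => (hfin i).trans_eq ?_
    field_simp
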